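/- **Proposition 3.3.** Let $n\ge 0$, and let $G_{0n}$ be the group (under $(X\circ Y)(u)=X(Y(u))$) of formal diffeomorphisms of $\mathbb R^n$ fixing $0$: the $n$-tuples $X^i(u)=\sum_{\mathbf i} x^{i,\mathbf i}u^{\mathbf i}\in\mathbb R[[u^1,\dots,u^n]]$ with $x^{i,0}=0$ and invertible linear part. The $x^{i,\mathbf i}$ with $\mathbf i\neq 0$ are coordinates on $G_{0n}$; $C^\infty(G_{0n})$ consists of the smooth functions of finitely many of them. Write $(X_{*u})^i_k=\partial X^i(u)/\partial u^k$; repeated indices are summed. A *Poisson–Lie structure* on $G_{0n}$ is a family $\Omega^{ij}[X](u,v)=\sum\omega^{(i,\mathbf i)(j,\mathbf j)}(X)\,u^{\mathbf i}v^{\mathbf j}$ in $C^\infty(G_{0n})[[u,v]]$ in which only nonzero multi-indices $\mathbf i,\mathbf j$ occur, such that (a) $\Omega^{ij}[X](u,v)=-\Omega^{ji}[X](v,u)$; (b) $\Omega^{ij}[X\circ Y](u,v)=\Omega^{ij}[X](Y(u),Y(v))+(X_{*Y(u)})^i_k(X_{*Y(v)})^j_l\,\Omega^{kl}[Y](u,v)$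 for all $X,Y\in G_{0n}$; (c) the bracket $\{F,G\}=\sum_{c,d}\frac{\partial F}{\partial x^{c}}\frac{\partial G}{\partial x^{d}}\,\omega^{cd}$, for which $\{X^i(u),X^j(v)\}=\Omega^{ij}(u,v)$, satisfies the Jacobi identities $$\{\{X^i(u),X^j(v)\},X^k(w)\}+\{\{X^k(w),X^i(u)\},X^j(v)\}+\{\{X^j(v),X^k(w)\},X^i(u)\}=0 .\qquad(\mathrm J)$$ Let $\varphi^{ij}(u,v)\in\mathbb R[[u,v]]$, $1\le i,j\le n$, satisfy $\varphi^{ij}(u,v)=-\varphi^{ji}(v,u)$, and put $$\Omega^{ij}[X](u,v)=(X_{*u})^i_k(X_{*v})^j_l\,\varphi^{kl}(u,v)-\varphi^{ij}(X(u),X(v)),$$ $$\begin{aligned}\Phi^{ijk}(u,v,w)={}&\varphi^{ks}(w,u)\frac{\partial\varphi^{ij}(u,v)}{\partial u^s}+\varphi^{sk}(v,w)\frac{\partial\varphi^{ji}(v,u)}{\partial v^s}+\varphi^{is}(u,v)\frac{\partial\varphi^{jk}(v,w)}{\partial v^s}\\&+\varphi^{si}(w,u)\frac{\partial\varphi^{kj}(w,v)}{\partial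 w^s}+\varphi^{js}(v,w)\frac{\partial\varphi^{ki}(w,u)}{\partial w^s}+\varphi^{sj}(u,v)\frac{\partial\varphi^{ik}(u,w)}{\partial u^s}.\end{aligned}$$ Call $\Phi$ *$G_{0n}$-invariant* if for all $X\in G_{0n}$ and all $i,j,k$ $$\Phi^{ijk}(X(u),X(v),X(w))=(X_{*u})^i_s(X_{*v})^j_q(X_{*w})^k_t\,\Phi^{sqt}(u,v,w).$$ 1. (Arbitrary $\varphi$.) Read (J) at the points $X\in G_{0n}$ with the constant terms $x^{s,0}$ also treated as coordinates, that is, $\{F,X^k(w)\}=\sum_{s,\mathbf s}\frac{\partial F}{\partial x^{s,\mathbf s}}\{x^{s,\mathbf s},X^k(w)\}$ over all multi-indices $\mathbf s$, including $0$; here $\frac{\partial F}{\partial x^{s,\mathbf s}}(X)$, for $F$ a coefficient of $\Omega$, is the coefficient of $\varepsilon$ ($\varepsilon^2=0$) in $F$ after replacing $X^s(u)$ by $X^s(u)+\varepsilon u^{\mathbf s}$. Then (J) holds if and only if $\Phi$ is $G_{0n}$-invariant; and equally (a), (b) and (J) hold together if and only if $\Phi$ is $G_{0n}$-invariant. 2.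 (Structures on $G_{0n}$.) $\Omega$ is a Poisson–Lie structure on $G_{0n}$ if and only if $\varphi^{ij}(0,v)=0$ for all $i,j$ and $\Phi$ is $G_{0n}$-invariant. If $\varphi^{ij}(0,v)=0$ for all $i,j$, then (c) alone holds if and only if $\Phi$ is $G_{0n}$-invariant. 3. In particular, if $\Phi=0$ (the classical Yang–Baxter equation), then (J) holds in the sense of 1, and if moreover $\varphi^{ij}(0,v)=0$ for all $i,j$, then $\Omega$ is a Poisson–Lie structure on $G_{0n}$. -/

import Mathlib

open MvPowerSeries

/-! Formal diffeomorphisms of `ℝⁿ` and Poisson tensors on the group they form.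

A series in `m` points `u, v, …` of `ℝⁿ` is an element of `MvPowerSeries (Fin m × Fin n) R`:
the variable `(p, s)` is the `s`-th coordinate of the `p`-th point. -/

namespace FormalDiff

noncomputable section

/-- An `n`-tuple of formal power series in `n` variables: a formal map of `n`-space. -/
abbrev FMap (n : ℕ) (R : Type*) : Type _ := Fin n → MvPowerSeries (Fin n) R

/-- A tensor with two upper indices depending on two points `u` (index `0`), `v` (index `1`). -/
abbrev Tensor2 (n : ℕ) (R : Type*) : Type _ :=
  Fin n → Fin n → MvPowerSeries (Fin 2 × Fin n) R

/-- A tensor with three upper indices depending on three points `u, v, w`. -/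
abbrev Tensor3 (n : ℕ) (R : Type*) : Type _ :=
  Fin n → Fin n → Fin n → MvPowerSeries (Fin 3 × Fin n) R

/-! ### Evaluation at points -/

section Points

variable {n m l : ℕ} {R : Type*} [CommRing R]

/-- `f(u)`, where `u` is the `p`-th of `m` points. -/
def atPt (p : Fin m) (f : MvPowerSeries (Fin n) R) : MvPowerSeries (Fin m × Fin n) R :=
  rename (fun s : Fin n => (p, s)) f

/-- `f` evaluated at the points listed by `c`: for `c = ![2, 0]` and points `(u, v, w)`
this is `f(w, u)`. -/
def atPts (c : Fin l → Fin m) (f : MvPowerSeries (Fin l × Fin n) R) :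
    MvPowerSeries (Fin m × Fin n) R :=
  rename (fun q : Fin l × Fin n => (c q.1, q.2)) f

/-- `f(X(u), X(v), …)`; the coefficients of `f` are real, those of `X` may be in any
`ℝ`-algebra `R`. -/
def pullback [Algebra ℝ R] (X : FMap n R) (f : MvPowerSeries (Fin m × Fin n) ℝ) :
    MvPowerSeries (Fin m × Fin n) R :=
  subst (fun q : Fin m × Fin n => atPt q.1 (X q.2)) f

/-- The entry `(X_{*u})^i_k = ∂X^i(u)/∂u^k` of the derivative of `X`. -/
def jac (X : FMap n R) (i k : Fin n) : MvPowerSeries (Fin n) R := pderiv R k (X i)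

end Points

/-! ### The group of formal diffeomorphisms fixing the origin -/

/-- The formal diffeomorphisms of `ℝⁿ` fixing `0`: tuples of series without constant term whose
linear part is invertible. -/
def G0 (n : ℕ) : Set (FMap n ℝ) :=
  {X | (∀ i, constantCoeff (X i) = 0) ∧
    (Matrix.of fun i k : Fin n => coeff (Finsupp.single k 1) (X i)).det ≠ 0}

/-- The product of the group, `(X ∘ Y)(u) = X(Y(u))`. -/
def comp {n : ℕ} (X Y : FMap n ℝ) : FMap n ℝ := fun i => subst Y (X i)

/-- Labels `(i, 𝐢)` of the coordinates `x^{i,𝐢}` of the group, where `𝐢` is a nonzero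
multi-index: `x^{i,𝐢}(X)` is the coefficient of `u^𝐢` in `X^i(u)`. -/
abbrev Coord (n : ℕ) : Type := Fin n × {a : Fin n →₀ ℕ // a ≠ 0}

/-- Smooth functions on the group: smooth functions of finitely many coordinates. -/
def IsSmooth {n : ℕ} (F : FMap n ℝ → ℝ) : Prop :=
  ∃ (S : Finset (Coord n)) (g : (S → ℝ) → ℝ),
    ContDiffOn ℝ ((⊤ : ℕ∞) : WithTop ℕ∞) g
      ((fun (X : FMap n ℝ) (c : S) => coeff c.1.2.1 (X c.1.1)) '' G0 n) ∧
    ∀ X ∈ G0 n, F X = g (fun c : S => coeff c.1.2.1 (X c.1.1))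

/-- The partial derivative `∂F/∂x^c` of a function on the group. -/
def partialX {n : ℕ} (c : Coord n) (F : FMap n ℝ → ℝ) (X : FMap n ℝ) : ℝ :=
  deriv (fun t : ℝ => F (X + Pi.single c.1 (monomial c.2.1 t))) 0

/-! ### Poisson tensors on the group -/

/-- The exponent of the monomial `u^a v^b`. -/
def pairExp {n : ℕ} (a b : Fin n →₀ ℕ) : Fin 2 × Fin n →₀ ℕ :=
  a.mapDomain (fun s => ((0 : Fin 2), s)) + b.mapDomain (fun s => ((1 : Fin 2), s))

/-- The bracket `{F, G} = ∑ (∂F/∂x^c) (∂G/∂x^d) ω^{c d}` of functions on the group, where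
`ω^{(i,𝐢)(j,𝐣)}` is the coefficient of `u^𝐢 v^𝐣` in `Ω^{ij}`. The sums are finite for smooth
functions. -/
def bracket {n : ℕ} (Ω : FMap n ℝ → Tensor2 n ℝ) (F G : FMap n ℝ → ℝ) (X : FMap n ℝ) : ℝ :=
  ∑ᶠ c : Coord n, ∑ᶠ d : Coord n,
    partialX c F X * partialX d G X * coeff (pairExp c.2.1 d.2.1) (Ω X c.1 d.1)

/-- The series `{{X^i(u), X^j(v)}, X^k(w)}` in `u, v, w`, where `{X^i(u), X^j(v)}` is
`Ω^{ij}` and the outer bracket is taken coefficient by coefficient. -/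
def doubleBracket {n : ℕ} (Ω : FMap n ℝ → Tensor2 n ℝ) (X : FMap n ℝ) : Tensor3 n ℝ :=
  fun i j k e =>
    bracket Ω (fun X' => coeff (pairExp (e.curry 0) (e.curry 1)) (Ω X' i j))
      (fun X' => coeff (e.curry 2) (X' k)) X

/-- Sum over the cyclic permutations of `(i,u), (j,v), (k,w)`:
`T^{ijk}(u,v,w) + T^{kij}(w,u,v) + T^{jki}(v,w,u)`. -/
def cyclicSum {n : ℕ} (T : Tensor3 n ℝ) : Tensor3 n ℝ := fun i j k =>
  T i j k + atPts ![2, 0, 1] (T k i j) + atPts ![1, 2, 0] (T j k i)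

/-- The Jacobi identities for `{X^i(u), X^j(v)} = Ω^{ij}`. -/
def IsJacobi {n : ℕ} (Ω : FMap n ℝ → Tensor2 n ℝ) : Prop :=
  ∀ X ∈ G0 n, ∀ i j k, cyclicSum (doubleBracket Ω X) i j k = 0

/-- `Ω^{ij}(u,v) = -Ω^{ji}(v,u)`. -/
def IsSkew {n : ℕ} (T : Tensor2 n ℝ) : Prop :=
  ∀ i j, T i j = - atPts ![1, 0] (T j i)

/-- Compatibility with the group structure: for `Z = X ∘ Y`,
`Ω[Z]^{ij}(u,v) = Ω[X]^{ij}(Y(u),Y(v)) + ∑ (X_{*Y(u)})^i_k (X_{*Y(v)})^j_l Ω[Y]^{kl}(u,v)`. -/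
def IsMultiplicative {n : ℕ} (Ω : FMap n ℝ → Tensor2 n ℝ) : Prop :=
  ∀ X ∈ G0 n, ∀ Y ∈ G0 n, ∀ i j,
    Ω (comp X Y) i j = pullback Y (Ω X i j) +
      ∑ k, ∑ l, atPt 0 (subst Y (jac X i k)) * atPt 1 (subst Y (jac X j l)) * Ω Y k l

/-- Poisson-Lie structures on the group. The first two fields say that `Ω` is a tensor on the
group: its components are smooth functions, and only the components labelled by pairs of
coordinates (nonzero multi-indices) occur. -/
structure IsPoissonLie {n : ℕ} (Ω : FMap n ℝ → Tensor2 n ℝ) : Prop where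
  smooth : ∀ i j e, IsSmooth fun X => coeff e (Ω X i j)
  tangent : ∀ X ∈ G0 n, ∀ i j a b, a = 0 ∨ b = 0 → coeff (pairExp a b) (Ω X i j) = 0
  skew : ∀ X ∈ G0 n, IsSkew (Ω X)
  multiplicative : IsMultiplicative Ω
  jacobi : IsJacobi Ω

/-! ### The coboundary tensor and its cubic invariant -/

/-- `Ω^{ij} = ∑ (X_{*u})^i_k (X_{*v})^j_l φ^{kl}(u,v) - φ^{ij}(X(u),X(v))`. -/
def coboundary {n : ℕ} {R : Type*} [CommRing R] [Algebra ℝ R] (φ : Tensor2 n ℝ) (X : FMap n R) :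
    Tensor2 n R := fun i j =>
  (∑ k, ∑ l, atPt 0 (jac X i k) * atPt 1 (jac X j l) *
    MvPowerSeries.map (algebraMap ℝ R) (φ k l)) - pullback X (φ i j)

/-- The cubic expression `Φ^{ijk}(u,v,w)`. -/
def Phi {n : ℕ} (φ : Tensor2 n ℝ) : Tensor3 n ℝ := fun i j k => ∑ s,
  (atPts ![2, 0] (φ k s) * pderiv ℝ (0, s) (atPts ![0, 1] (φ i j)) +
   atPts ![1, 2] (φ s k) * pderiv ℝ (1, s) (atPts ![1, 0] (φ j i)) +
   atPts ![0, 1] (φ i s) * pderiv ℝ (1, s) (atPts ![1, 2] (φ j k)) +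
   atPts ![2, 0] (φ s i) * pderiv ℝ (2, s) (atPts ![2, 1] (φ k j)) +
   atPts ![1, 2] (φ j s) * pderiv ℝ (2, s) (atPts ![2, 0] (φ k i)) +
   atPts ![0, 1] (φ s j) * pderiv ℝ (0, s) (atPts ![0, 2] (φ i k)))

/-- Invariance of a tensor at three points under the formal diffeomorphisms fixing `0`:
`T^{ijk}(X(u),X(v),X(w)) = ∑ (X_{*u})^i_s (X_{*v})^j_q (X_{*w})^k_t T^{sqt}(u,v,w)`. -/
def IsInvariant {n : ℕ} (T : Tensor3 n ℝ) : Prop :=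
  ∀ X ∈ G0 n, ∀ i j k, pullback X (T i j k) =
    ∑ s, ∑ q, ∑ t, atPt 0 (jac X i s) * atPt 1 (jac X j q) * atPt 2 (jac X k t) * T s q t

/-- `φ^{ij}(0, v) = 0`. -/
def VanishesAtZero {n : ℕ} (φ : Tensor2 n ℝ) : Prop :=
  ∀ i j b, coeff (pairExp 0 b) (φ i j) = 0

/-! ### The Jacobi identities when constant terms are allowed to vary

If `φ(0,v) ≠ 0`, the coboundary tensor has nonzero components `{x^{i,0}, x^{j,𝐣}}`. Brackets then
also involve derivatives in the directions of the constant terms `x^{s,0}`. A series cannot be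
substituted at a nonzero real point, so partial derivatives at `X ∈ G0 n` are taken over the dual
numbers `ℝ[ε]`: `∂/∂x^{s,𝐬}` is the coefficient of `ε` after replacing `X^s(u)` by
`X^s(u) + ε u^𝐬`. -/

/-- `X^s(u) + ε u^a` in the `s`-th component, and `X` in the other ones. -/
def perturb {n : ℕ} (X : FMap n ℝ) (s : Fin n) (a : Fin n →₀ ℕ) : FMap n (DualNumber ℝ) :=
  fun i => MvPowerSeries.map (algebraMap ℝ (DualNumber ℝ)) (X i) +
    Pi.single (M := fun _ => MvPowerSeries (Fin n) (DualNumber ℝ)) s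
      (monomial a DualNumber.eps) i

/-- The series `{{X^i(u), X^j(v)}, X^k(w)}` for the coboundary tensor, where the sum
`{F, X^k(w)} = ∑ (∂F/∂x^{s,𝐬}) {x^{s,𝐬}, X^k(w)}` is over all multi-indices `𝐬`, the zero one
included. The sum is finite. -/
def formalDoubleBracket {n : ℕ} (φ : Tensor2 n ℝ) (X : FMap n ℝ) : Tensor3 n ℝ :=
  fun i j k e => ∑ᶠ c : Fin n × (Fin n →₀ ℕ),
    TrivSqZeroExt.snd
        (coeff (pairExp (e.curry 0) (e.curry 1)) (coboundary φ (perturb X c.1 c.2) i j)) *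
      coeff (pairExp c.2 (e.curry 2)) (coboundary φ X c.1 k)

/-- The Jacobi identities for the coboundary tensor at all points of the group, as identities
between formal series in which constant terms are allowed to vary. -/
def IsFormalJacobi {n : ℕ} (φ : Tensor2 n ℝ) : Prop :=
  ∀ X ∈ G0 n, ∀ i j k, cyclicSum (formalDoubleBracket φ X) i j k = 0

end

end FormalDiff

/-! Write `J` for the Jacobian of `X` and `X^*` for substitution of `X` at every point, so that
`Ω[X]` is `(J ⊗ J) φ - X^* φ`. Skewness is inherited from `φ`, and multiplicativity is the chain
rule for `J`. All the content lies in the Jacobi identity.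

The bracket `{{X^i(u), X^j(v)}, X^k(w)}` is the derivative of `X ↦ Ω^{ij}[X](u,v)` in the direction
`δX^s = Ω^{sk}(·,w)`. It splits into two half brackets, according to whether `δX` is taken at `u` or
at `v`, so the cyclic sum has six of them, two for each point. In the difference of the two at one
point (`halfBracket_sub`), the terms with second derivatives of `X` cancel because partial
derivatives commute, and the terms mixing `J` with `X^* ∂φ` cancel crosswise. What is left sums to
`(J ⊗ J ⊗ J) Φ - X^* Φ` (`cyclicSum_doubleBracketSeries`), which vanishes for all `X` exactly when
`Φ` is invariant.

To identify the bracket, a sum over coordinates, with this directional derivative,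
`formalDoubleBracket_eq` evaluates a linear map on monomials. `CoeffFinite` plays the role of
continuity there and in the chain rule `leibniz_subst`. The coefficients of `Ω` are polynomials in
those of `X`, so by `map_coboundary` real partial derivatives agree with those over the dual
numbers.

On the group itself, `Ω` must have no component with a zero multi-index. At `u = 0` this makes
`φ(0,v)` equivariant, and suitable diagonal and quadratic maps force it to be `0`
(`vanishesAtZero_of_tangent`). Conversely, if `φ(0,v) = 0`, constant-term directions contribute
nothing and both forms of the Jacobi identity coincide (`doubleBracket_coboundary`). -/

namespace FormalDiff

noncomputable section

/-! ### Maps whose values depend on finitely many coefficients at a time -/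

section CoeffFinite

variable {I M Z σ τ υ A R S : Type*}

/-- Each coefficient of `L m` vanishes as soon as finitely many of the coordinates `x c m` do. -/
def CoeffFinite [Zero Z] [Semiring S] (x : I → M → Z) (L : M → MvPowerSeries τ S) : Prop :=
  ∀ e, ∃ T : Finset I, ∀ m, (∀ c ∈ T, x c m = 0) → coeff e (L m) = 0

/-- `CoeffFinite` for maps between rings of power series. -/
abbrev CoeffCont [Semiring R] [Semiring S] (O : MvPowerSeries σ R → MvPowerSeries τ S) : Prop :=
  CoeffFinite (fun (d : σ →₀ ℕ) f => coeff d f) O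

theorem CoeffCont.of [Semiring R] [Semiring S] {O : MvPowerSeries σ R → MvPowerSeries τ S}
    (h : ∀ e, ∃ T : Finset (σ →₀ ℕ), ∀ f, (∀ d ∈ T, coeff d f = 0) → coeff e (O f) = 0) :
    CoeffCont O :=
  h

theorem subst_zero [CommRing A] [CommRing S] [Algebra A S] {a : σ → MvPowerSeries τ S}
    (ha : HasSubst a) : subst a (0 : MvPowerSeries σ A) = 0 := by
  rw [← substAlgHom_apply ha, map_zero]

theorem subst_one [CommRing A] [CommRing S] [Algebra A S] {a : σ → MvPowerSeries τ S}
    (ha : HasSubst a) : subst a (1 : MvPowerSeries σ A) = 1 := by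
  rw [← substAlgHom_apply ha, map_one]

theorem CoeffCont.comp_coeffFinite [Zero Z] [Semiring R] [Semiring S] {x : I → M → Z}
    {O : MvPowerSeries σ R → MvPowerSeries τ S} {L : M → MvPowerSeries σ R}
    (hO : CoeffCont O) (hL : CoeffFinite x L) : CoeffFinite x fun m => O (L m) := by
  classical
  intro e
  obtain ⟨T, hT⟩ := hO e
  choose U hU using hL
  exact ⟨T.biUnion U, fun m hm => hT _ fun d hd => hU d m fun c hc =>
    hm c (Finset.mem_biUnion.2 ⟨d, hd, hc⟩)⟩

theorem CoeffFinite.add [Zero Z] [Semiring S] {x : I → M → Z} {L L' : M → MvPowerSeries τ S}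
    (h : CoeffFinite x L) (h' : CoeffFinite x L') : CoeffFinite x fun m => L m + L' m := by
  classical
  intro e
  obtain ⟨T, hT⟩ := h e
  obtain ⟨T', hT'⟩ := h' e
  refine ⟨T ∪ T', fun m hm => ?_⟩
  rw [map_add, hT m fun c hc => hm c (Finset.mem_union_left _ hc),
    hT' m fun c hc => hm c (Finset.mem_union_right _ hc), add_zero]

theorem CoeffFinite.neg [Zero Z] [Ring S] {x : I → M → Z} {L : M → MvPowerSeries τ S}
    (h : CoeffFinite x L) : CoeffFinite x fun m => - L m := by
  intro e
  obtain ⟨T, hT⟩ := h e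
  exact ⟨T, fun m hm => by rw [map_neg, hT m hm, neg_zero]⟩

theorem CoeffFinite.sub [Zero Z] [Ring S] {x : I → M → Z} {L L' : M → MvPowerSeries τ S}
    (h : CoeffFinite x L) (h' : CoeffFinite x L') : CoeffFinite x fun m => L m - L' m := by
  simpa only [sub_eq_add_neg] using h.add h'.neg

theorem CoeffFinite.zero [Zero Z] [Semiring S] {x : I → M → Z} :
    CoeffFinite x fun _ => (0 : MvPowerSeries τ S) :=
  fun _ => ⟨∅, fun _ _ => coeff_zero _⟩

theorem CoeffFinite.sum [Zero Z] [Semiring S] {x : I → M → Z} {ι : Type*} (s : Finset ι)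
    {L : ι → M → MvPowerSeries τ S} (h : ∀ i, CoeffFinite x (L i)) :
    CoeffFinite x fun m => ∑ i ∈ s, L i m := by
  classical
  induction s using Finset.induction_on with
  | empty => simpa using CoeffFinite.zero
  | insert a s ha ih => simpa [Finset.sum_insert ha] using (h a).add ih

theorem CoeffFinite.const_mul [Zero Z] [Semiring S] {x : I → M → Z} {L : M → MvPowerSeries τ S}
    (h : CoeffFinite x L) (a : MvPowerSeries τ S) : CoeffFinite x fun m => a * L m := by
  classical
  refine CoeffCont.comp_coeffFinite (O := fun f => a * f) (.of fun e => ?_) h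
  refine ⟨(Finset.HasAntidiagonal.antidiagonal e).image Prod.snd, fun f hf => ?_⟩
  rw [coeff_mul]
  exact Finset.sum_eq_zero fun p hp => by
    rw [hf _ (Finset.mem_image_of_mem _ hp), mul_zero]

theorem CoeffFinite.mul_const [Zero Z] [CommSemiring S] {x : I → M → Z}
    {L : M → MvPowerSeries τ S} (h : CoeffFinite x L) (a : MvPowerSeries τ S) :
    CoeffFinite x fun m => L m * a := by
  simpa only [mul_comm] using h.const_mul a

theorem CoeffCont.id [Semiring R] : CoeffCont fun f : MvPowerSeries σ R => f :=
  fun e => ⟨{e}, fun _ hf => hf e (Finset.mem_singleton_self e)⟩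

theorem coeffCont_pderiv [CommSemiring R] (k : σ) : CoeffCont (pderiv R k) :=
  .of fun e => ⟨{e + Finsupp.single k 1}, fun _ hf => by
    rw [coeff_pderiv, hf _ (Finset.mem_singleton_self _), zero_mul]⟩

theorem coeffCont_rename [CommSemiring R] (g : σ → τ) [Filter.TendstoCofinite g] :
    CoeffCont (rename (R := R) g) :=
  fun e => ⟨_, fun _ hf => by rw [coeff_rename]; exact Finset.sum_eq_zero hf⟩

theorem coeffCont_map [Semiring R] [Semiring S] (h : R →+* S) :
    CoeffCont (MvPowerSeries.map (σ := σ) h) :=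
  .of fun e => ⟨{e}, fun _ hf => by rw [coeff_map, hf _ (Finset.mem_singleton_self _), map_zero]⟩

theorem coeffCont_killCompl [CommSemiring R] (g : σ ↪ τ) : CoeffCont (killCompl (R := R) g) :=
  .of fun e => ⟨{Finsupp.embDomain g e}, fun _ hf => by
    rw [coeff_killCompl, hf _ (Finset.mem_singleton_self _)]⟩

theorem coeffCont_subst [CommRing A] [CommRing S] [Algebra A S] {a : σ → MvPowerSeries τ S}
    (ha : HasSubst a) : CoeffCont (subst a : MvPowerSeries σ A → MvPowerSeries τ S) := by
  refine .of fun e => ?_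
  -- The all-ones series detects every exponent `d` whose product `a^d` contributes at `e`, so the
  -- finite set does not depend on `f`.
  have hfin := coeff_subst_finite (R := A) ha (fun _ => (1 : A)) e
  refine ⟨hfin.toFinset, fun f hf => ?_⟩
  rw [coeff_subst ha]
  refine finsum_eq_zero_of_forall_eq_zero fun d => ?_
  by_cases hd : d ∈ hfin.toFinset
  · rw [hf d hd, zero_smul]
  · have h0 : coeff e (d.prod fun s e => (a s) ^ e) = 0 := by
      have h1 : coeff d (fun _ => (1 : A) : MvPowerSeries σ A) = 1 := rfl
      by_contra hne
      exact hd (hfin.mem_toFinset.2 (by simpa [h1] using hne))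
    rw [h0, smul_zero]

/-- A coefficientwise finite additive map is determined by its values on polynomials. -/
theorem CoeffCont.ext [CommRing A] [CommRing S] {L L' : MvPowerSeries σ A →+ MvPowerSeries τ S}
    (hL : CoeffCont L) (hL' : CoeffCont L')
    (h : ∀ p : MvPolynomial σ A, L p = L' p) (f : MvPowerSeries σ A) : L f = L' f := by
  classical
  ext e
  obtain ⟨T, hT⟩ := hL.sub hL' e
  -- The truncation of `f` to the exponents that the coefficient at `e` can see.
  let p : MvPolynomial σ A := ∑ d ∈ T, MvPolynomial.monomial d (coeff d f)
  have hp : ∀ d ∈ T, coeff d (f - (p : MvPowerSeries σ A)) = 0 := by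
    intro d hd
    simp only [map_sub, MvPolynomial.coeff_coe, p, MvPolynomial.coeff_sum,
      MvPolynomial.coeff_monomial]
    simp [hd]
  have := hT _ hp
  simp only [map_sub, h] at this
  linear_combination this

/-- The variables generate the polynomials, and `CoeffCont.ext` passes from polynomials to series.
-/
theorem algHom_eq_of_X [CommRing A] [CommRing S] [Algebra A S]
    {L L' : MvPowerSeries σ A →ₐ[A] MvPowerSeries τ S} (hL : CoeffCont L) (hL' : CoeffCont L')
    (h : ∀ s, L (X s) = L' (X s)) (f : MvPowerSeries σ A) : L f = L' f := by
  refine CoeffCont.ext (L := (L : MvPowerSeries σ A →+ MvPowerSeries τ S))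
    (L' := (L' : MvPowerSeries σ A →+ MvPowerSeries τ S)) hL hL' (fun p => ?_) f
  have : L.comp (MvPolynomial.coeToMvPowerSeries.algHom A) =
      L'.comp (MvPolynomial.coeToMvPowerSeries.algHom A) := by
    apply MvPolynomial.algHom_ext
    intro s
    simpa [MvPolynomial.coeToMvPowerSeries.algHom_apply] using h s
  simpa [MvPolynomial.coeToMvPowerSeries.algHom_apply] using DFunLike.congr_fun this p

/-- Chain rule: a derivation `D` along an algebra homomorphism `π`, applied to a substitution. -/
theorem leibniz_subst [CommRing A] [CommRing R] [CommRing S] [Algebra A R] [Algebra A S]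
    [Fintype σ] (π : MvPowerSeries τ S →ₐ[A] MvPowerSeries υ R)
    (D : MvPowerSeries τ S →ₗ[A] MvPowerSeries υ R)
    (hD : ∀ f g, D (f * g) = π f * D g + π g * D f)
    (hπ : CoeffCont π) (hD' : CoeffCont D) {a : σ → MvPowerSeries τ S} (ha : HasSubst a)
    (f : MvPowerSeries σ A) :
    D (subst a f) = ∑ q, π (subst a (pderiv A q f)) * D (a q) := by
  classical
  -- The Leibniz rule gives `D 1 = D 1 + D 1`.
  have hD1 : D 1 = 0 := by simpa using hD 1 1
  let L : MvPowerSeries σ A →+ MvPowerSeries υ R :=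
    { toFun := fun f => D (subst a f)
      map_zero' := by rw [subst_zero ha, map_zero]
      map_add' := fun f g => by rw [subst_add ha, map_add] }
  let L' : MvPowerSeries σ A →+ MvPowerSeries υ R :=
    { toFun := fun f => ∑ q, π (subst a (pderiv A q f)) * D (a q)
      map_zero' := by simp [subst_zero ha]
      map_add' := fun f g => by simp [subst_add ha, add_mul, Finset.sum_add_distrib] }
  refine CoeffCont.ext (L := L) (L' := L') (hD'.comp_coeffFinite (coeffCont_subst ha))
    (CoeffFinite.sum _ fun q => (hπ.comp_coeffFinite
      ((coeffCont_subst ha).comp_coeffFinite (coeffCont_pderiv q))).mul_const _) (fun p => ?_) f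
  induction p using MvPolynomial.induction_on with
  | C r =>
    simp only [L, L', AddMonoidHom.coe_mk, ZeroHom.coe_mk, MvPolynomial.coe_C, pderiv_C]
    have h0 : subst a (C r : MvPowerSeries σ A) = r • (1 : MvPowerSeries τ S) := by
      rw [← substAlgHom_apply ha, c_eq_algebraMap, AlgHom.commutes, Algebra.algebraMap_eq_smul_one]
    rw [h0, map_smul, hD1]
    simp [subst_zero ha]
  | add p q hp hq => rw [MvPolynomial.coe_add, map_add, map_add, hp, hq]
  | mul_X p s hp =>
    simp only [L, L', AddMonoidHom.coe_mk, ZeroHom.coe_mk] at hp ⊢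
    rw [MvPolynomial.coe_mul, subst_mul ha, hD, hp, MvPolynomial.coe_X, subst_X ha, Finset.mul_sum]
    simp only [Derivation.leibniz, smul_eq_mul, subst_add ha, subst_mul ha, map_add, map_mul,
      add_mul, Finset.sum_add_distrib, subst_X ha]
    congr 1
    · rw [Finset.sum_eq_single s]
      · rw [pderiv_X_self]
        simp [subst_one ha]
      · intro b _ hb
        rw [pderiv_X_of_ne hb.symm]
        simp [subst_zero ha]
      · simp
    · exact Finset.sum_congr rfl fun q _ => by ring

theorem pderiv_subst [CommRing R] [Fintype σ] (k : τ) {a : σ → MvPowerSeries τ R}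
    (ha : HasSubst a) (f : MvPowerSeries σ R) :
    pderiv R k (subst a f) = ∑ q, subst a (pderiv R q f) * pderiv R k (a q) :=
  leibniz_subst (AlgHom.id R _) (pderiv R k).toLinearMap (fun f g => by simp)
    CoeffCont.id (coeffCont_pderiv k) ha f

theorem map_subst_algHom [CommRing A] [CommRing R] [CommRing S] [Algebra A R] [Algebra A S]
    (h : R →ₐ[A] S) {a : σ → MvPowerSeries τ R} (ha : HasSubst a) (f : MvPowerSeries σ A) :
    MvPowerSeries.map (h : R →+* S) (subst a f) =
      subst (fun s => MvPowerSeries.map (h : R →+* S) (a s)) f := by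
  have ha' := ha.map (h : R →+* S)
  have := algHom_eq_of_X (L := (mapAlgHom h).comp (substAlgHom ha)) (L' := substAlgHom ha')
    ((coeffCont_map (h : R →+* S)).comp_coeffFinite
      (by simpa using coeffCont_subst (A := A) ha)) (by simpa using coeffCont_subst (A := A) ha')
    (fun s => by simp [subst_X ha, subst_X ha', mapAlgHom_apply]) f
  simpa [mapAlgHom_apply] using this

end CoeffFinite

/-! ### Calculus of series in several points -/

section Rename

variable {σ τ R : Type*} [CommRing R] [Fintype σ]

theorem pderiv_rename (g : σ ↪ τ) (k : σ) (f : MvPowerSeries σ R) :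
    pderiv R (g k) (rename g f) = rename g (pderiv R k f) := by
  rw [rename_eq_subst, rename_eq_subst, pderiv_subst _ (HasSubst.X_comp _), Finset.sum_eq_single k]
  · simp [pderiv_X_self]
  · intro b _ hb
    rw [Function.comp_apply, pderiv_X_of_ne (g.injective.ne hb), mul_zero]
  · simp

theorem pderiv_rename_of_notMem_range (g : σ → τ) [Filter.TendstoCofinite g] {t : τ}
    (ht : t ∉ Set.range g) (f : MvPowerSeries σ R) : pderiv R t (rename g f) = 0 := by
  rw [rename_eq_subst, pderiv_subst _ (HasSubst.X_comp _)]
  refine Finset.sum_eq_zero fun q _ => ?_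
  rw [Function.comp_apply, pderiv_X_of_ne (fun h => ht ⟨q, h⟩), mul_zero]

theorem pderiv_comm (a b : τ) (f : MvPowerSeries τ R) :
    pderiv R a (pderiv R b f) = pderiv R b (pderiv R a f) := by
  classical
  ext e
  rw [coeff_pderiv, coeff_pderiv, coeff_pderiv, coeff_pderiv, add_right_comm]
  by_cases h : a = b
  · subst h; rfl
  · simp [h, Ne.symm h]
    ring

theorem pderiv_map {S : Type*} [CommRing S] (h : R →+* S) (k : τ) (f : MvPowerSeries τ R) :
    pderiv S k (MvPowerSeries.map h f) = MvPowerSeries.map h (pderiv R k f) := by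
  ext e
  simp [coeff_pderiv]

end Rename

section Points

variable {n m l : ℕ} {R S : Type*} [CommRing R] [CommRing S]

theorem atPt_mul (p : Fin m) (f g : MvPowerSeries (Fin n) R) :
    atPt p (f * g) = atPt p f * atPt p g := map_mul _ _ _

theorem atPt_sum {ι : Type*} (p : Fin m) (s : Finset ι) (f : ι → MvPowerSeries (Fin n) R) :
    atPt p (∑ i ∈ s, f i) = ∑ i ∈ s, atPt p (f i) := map_sum _ _ _

theorem atPts_add (c : Fin l → Fin m) (f g : MvPowerSeries (Fin l × Fin n) R) :
    atPts c (f + g) = atPts c f + atPts c g := map_add _ _ _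

theorem atPts_sub (c : Fin l → Fin m) (f g : MvPowerSeries (Fin l × Fin n) R) :
    atPts c (f - g) = atPts c f - atPts c g := map_sub _ _ _

theorem atPts_neg (c : Fin l → Fin m) (f : MvPowerSeries (Fin l × Fin n) R) :
    atPts c (-f) = -atPts c f := map_neg _ _

theorem atPts_mul (c : Fin l → Fin m) (f g : MvPowerSeries (Fin l × Fin n) R) :
    atPts c (f * g) = atPts c f * atPts c g := map_mul _ _ _

theorem atPts_sum {ι : Type*} (c : Fin l → Fin m) (s : Finset ι)
    (f : ι → MvPowerSeries (Fin l × Fin n) R) :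
    atPts c (∑ i ∈ s, f i) = ∑ i ∈ s, atPts c (f i) := map_sum _ _ _

theorem atPts_atPts {k : ℕ} (c : Fin l → Fin m) (c' : Fin k → Fin l)
    (f : MvPowerSeries (Fin k × Fin n) R) : atPts c (atPts c' f) = atPts (c ∘ c') f :=
  rename_rename _ _ f

theorem atPts_atPt (c : Fin l → Fin m) (p : Fin l) (f : MvPowerSeries (Fin n) R) :
    atPts c (atPt p f) = atPt (c p) f :=
  rename_rename _ _ f

theorem map_atPt (h : R →+* S) (p : Fin m) (f : MvPowerSeries (Fin n) R) :
    MvPowerSeries.map h (atPt p f) = atPt p (MvPowerSeries.map h f) :=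
  (rename_map _ h f).symm

theorem map_jac (h : R →+* S) (X : FMap n R) (i k : Fin n) :
    MvPowerSeries.map h (jac X i k) = jac (fun i => MvPowerSeries.map h (X i)) i k :=
  (pderiv_map h k (X i)).symm

theorem pderiv_atPt (p : Fin m) (k : Fin n) (f : MvPowerSeries (Fin n) R) :
    pderiv R (p, k) (atPt p f) = atPt p (pderiv R k f) :=
  pderiv_rename ⟨fun s : Fin n => (p, s), Prod.mk_right_injective p⟩ k f

theorem pderiv_atPt_of_ne {p q : Fin m} (h : p ≠ q) (k : Fin n) (f : MvPowerSeries (Fin n) R) :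
    pderiv R (q, k) (atPt p f) = 0 :=
  pderiv_rename_of_notMem_range _ (by rintro ⟨s, hs⟩; exact h (congrArg Prod.fst hs)) f

theorem pderiv_atPts {c : Fin l → Fin m} (hc : Function.Injective c) (p : Fin l) (k : Fin n)
    (f : MvPowerSeries (Fin l × Fin n) R) :
    pderiv R (c p, k) (atPts c f) = atPts c (pderiv R (p, k) f) :=
  pderiv_rename ⟨fun q : Fin l × Fin n => (c q.1, q.2),
    fun _ _ h => Prod.ext (hc (congrArg Prod.fst h)) (congrArg Prod.snd h :)⟩ (p, k) f

/-- Series without invertible constant terms: those which can be substituted. -/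
def IsSubstitutable (X : FMap n R) : Prop := ∀ i, IsNilpotent (constantCoeff (X i))

theorem isSubstitutable_of_mem {X : FMap n ℝ} (hX : X ∈ G0 n) : IsSubstitutable X :=
  fun i => by rw [hX.1 i]; exact IsNilpotent.zero

theorem IsSubstitutable.hasSubst {X : FMap n R} (hX : IsSubstitutable X) : HasSubst X :=
  hasSubst_of_constantCoeff_nilpotent hX

theorem IsSubstitutable.hasSubst_atPt {X : FMap n R} (hX : IsSubstitutable X) (m : ℕ) :
    HasSubst fun q : Fin m × Fin n => atPt q.1 (X q.2) :=
  hasSubst_of_constantCoeff_nilpotent fun q => by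
    simpa [atPt] using hX q.2

variable [Algebra ℝ R] [Algebra ℝ S]

section pullback

variable {X : FMap n R} (hX : IsSubstitutable X)
include hX

theorem pullback_sub (f g : MvPowerSeries (Fin m × Fin n) ℝ) :
    pullback X (f - g) = pullback X f - pullback X g := subst_sub (hX.hasSubst_atPt m) f g

theorem pullback_mul (f g : MvPowerSeries (Fin m × Fin n) ℝ) :
    pullback X (f * g) = pullback X f * pullback X g := subst_mul (hX.hasSubst_atPt m) f g

theorem pullback_neg (f : MvPowerSeries (Fin m × Fin n) ℝ) :
    pullback X (-f) = -pullback X f := by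
  simp only [pullback, ← substAlgHom_apply (hX.hasSubst_atPt m), map_neg]

theorem pullback_add (f g : MvPowerSeries (Fin m × Fin n) ℝ) :
    pullback X (f + g) = pullback X f + pullback X g := subst_add (hX.hasSubst_atPt m) f g

theorem pullback_sum {ι : Type*} (s : Finset ι) (f : ι → MvPowerSeries (Fin m × Fin n) ℝ) :
    pullback X (∑ i ∈ s, f i) = ∑ i ∈ s, pullback X (f i) := by
  simp only [pullback, ← substAlgHom_apply (hX.hasSubst_atPt m), map_sum]

theorem atPts_pullback (c : Fin l → Fin m) (f : MvPowerSeries (Fin l × Fin n) ℝ) :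
    atPts c (pullback X f) = pullback X (atPts c f) := by
  rw [atPts, rename_eq_subst, pullback, subst_comp_subst_apply (hX.hasSubst_atPt l)
    (HasSubst.X_comp _), pullback, atPts, rename_eq_subst,
    subst_comp_subst_apply (HasSubst.X_comp _) (hX.hasSubst_atPt m)]
  congr 1
  ext1 q
  rw [← rename_eq_subst, Function.comp_apply, subst_X (hX.hasSubst_atPt m)]
  exact atPts_atPt c q.1 (X q.2)

theorem map_pullback (h : R →ₐ[ℝ] S) (f : MvPowerSeries (Fin m × Fin n) ℝ) :
    MvPowerSeries.map (h : R →+* S) (pullback X f) =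
      pullback (fun i => MvPowerSeries.map (h : R →+* S) (X i)) f := by
  rw [pullback, map_subst_algHom h (hX.hasSubst_atPt m)]
  simp only [map_atPt, pullback]

/-- The coboundary tensor is natural in the coefficient ring. -/
theorem map_coboundary (h : R →ₐ[ℝ] S) (φ : Tensor2 n ℝ) (i j : Fin n) :
    MvPowerSeries.map (h : R →+* S) (coboundary φ X i j) =
      coboundary φ (fun i => MvPowerSeries.map (h : R →+* S) (X i)) i j := by
  simp only [coboundary, map_sub, map_sum, map_mul, map_atPt, map_jac, map_pullback hX]
  simp only [MvPowerSeries.map_map, AlgHom.comp_algebraMap]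

end pullback

variable {X : FMap n ℝ} (hX : IsSubstitutable X)

include hX in
theorem pullback_atPt (p : Fin m) (f : MvPowerSeries (Fin n) ℝ) :
    pullback X (atPt p f) = atPt p (subst X f) := by
  rw [atPt, rename_eq_subst, pullback, subst_comp_subst_apply (HasSubst.X_comp _)
    (hX.hasSubst_atPt m), atPt, rename_eq_subst,
    subst_comp_subst_apply hX.hasSubst (HasSubst.X_comp _)]
  congr 1
  ext1 q
  rw [← rename_eq_subst, Function.comp_apply, subst_X (hX.hasSubst_atPt m)]
  rfl

include hX in
theorem pderiv_pullback (p : Fin m) (k : Fin n) (f : MvPowerSeries (Fin m × Fin n) ℝ) :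
    pderiv ℝ (p, k) (pullback X f) =
      ∑ s, pullback X (pderiv ℝ (p, s) f) * atPt p (jac X s k) := by
  rw [pullback, pderiv_subst _ (hX.hasSubst_atPt m), Fintype.sum_prod_type, Finset.sum_eq_single p]
  · simp only [pderiv_atPt]
    rfl
  · intro q _ hq
    exact Finset.sum_eq_zero fun s _ => by rw [pderiv_atPt_of_ne hq, mul_zero]
  · simp

theorem pullback_comp {X Y : FMap n ℝ} (hX : IsSubstitutable X) (hY : IsSubstitutable Y)
    (f : MvPowerSeries (Fin m × Fin n) ℝ) :
    pullback (comp X Y) f = pullback Y (pullback X f) := by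
  rw [pullback, pullback, pullback, subst_comp_subst_apply (hX.hasSubst_atPt m)
    (hY.hasSubst_atPt m)]
  congr 1
  ext1 q
  exact (pullback_atPt hY q.1 (X q.2)).symm

theorem jac_comp (X : FMap n ℝ) {Y : FMap n ℝ} (hY : IsSubstitutable Y) (i k : Fin n) :
    jac (comp X Y) i k = ∑ s, subst Y (jac X i s) * jac Y s k :=
  pderiv_subst k hY.hasSubst (X i)

end Points

/-! ### Skew symmetry and multiplicativity of the coboundary tensor -/

section Cocycle

variable {n : ℕ} {φ : Tensor2 n ℝ}

theorem coboundary_eq (φ : Tensor2 n ℝ) (X : FMap n ℝ) (i j : Fin n) :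
    coboundary φ X i j =
      (∑ k, ∑ l, atPt 0 (jac X i k) * atPt 1 (jac X j l) * φ k l) - pullback X (φ i j) := by
  simp [coboundary, MvPowerSeries.map_id]

theorem isSkew_coboundary (hφ : IsSkew φ) {X : FMap n ℝ} (hX : IsSubstitutable X) :
    IsSkew (coboundary φ X) := by
  intro i j
  rw [coboundary_eq, coboundary_eq, atPts_sub, atPts_pullback hX]
  simp only [atPts_sum, atPts_mul, atPts_atPt]
  have h : ∀ k l, atPts ![1, 0] (φ k l) = -φ l k := fun k l => by rw [hφ l k, neg_neg]
  simp only [h, pullback_neg hX]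
  rw [Finset.sum_comm, neg_sub', sub_eq_add_neg, sub_eq_add_neg, ← Finset.sum_neg_distrib]
  congr 1
  swap
  · rw [neg_neg]
  refine Finset.sum_congr rfl fun k _ => ?_
  rw [← Finset.sum_neg_distrib]
  refine Finset.sum_congr rfl fun l _ => ?_
  simp only [Matrix.cons_val_zero, Matrix.cons_val_one]
  ring

/-- By the chain rule, the Jacobian of `comp X Y` is that of `X` at `Y(u)` times that of `Y`. The
term pairing the Jacobians of `X` with `φ(Y(u), Y(v))` occurs in both summands on the right with
opposite signs, and the outer terms give the left side. -/
theorem isMultiplicative_coboundary (φ : Tensor2 n ℝ) :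
    IsMultiplicative (coboundary (R := ℝ) φ) := by
  intro X hX Y hY i j
  replace hX := isSubstitutable_of_mem hX
  replace hY := isSubstitutable_of_mem hY
  simp only [coboundary_eq, pullback_sub hY, pullback_comp hX hY, jac_comp X hY, pullback_sum hY,
    pullback_mul hY, pullback_atPt hY, mul_sub, Finset.sum_sub_distrib]
  have h : ∀ k l, atPt (0 : Fin 2) (∑ s, subst Y (jac X i s) * jac Y s k) *
      atPt 1 (∑ s, subst Y (jac X j s) * jac Y s l) * φ k l =
      ∑ s, ∑ t, atPt 0 (subst Y (jac X i s)) * atPt 1 (subst Y (jac X j t)) *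
        (atPt 0 (jac Y s k) * atPt 1 (jac Y t l) * φ k l) := by
    intro k l
    rw [atPt_sum, atPt_sum, Finset.sum_mul_sum, Finset.sum_mul]
    refine Finset.sum_congr rfl fun s _ => ?_
    rw [Finset.sum_mul]
    refine Finset.sum_congr rfl fun t _ => ?_
    rw [atPt_mul, atPt_mul]
    ring
  simp only [h, Finset.mul_sum]
  have h' : ∀ F : Fin n → Fin n → Fin n → Fin n → MvPowerSeries (Fin 2 × Fin n) ℝ,
      ∑ k, ∑ l, ∑ s, ∑ t, F k l s t = ∑ s, ∑ t, ∑ k, ∑ l, F k l s t := by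
    intro F
    simpa only [Fintype.sum_prod_type] using Finset.sum_comm (s := Finset.univ) (t := Finset.univ)
      (f := fun p q : Fin n × Fin n => F p.1 p.2 q.1 q.2)
  rw [h']
  ring

end Cocycle

/-! ### The Jacobi identity of the coboundary tensor -/

section Jacobi

variable {n : ℕ} (φ : Tensor2 n ℝ)

/-- `φ^{ij}` evaluated at the `p`-th and the `q`-th of three points. -/
abbrev phiAt (p q : Fin 3) (i j : Fin n) : MvPowerSeries (Fin 3 × Fin n) ℝ := atPts ![p, q] (φ i j)

/-- The coboundary tensor at the `p`-th and the `q`-th of three points. -/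
abbrev coboundaryAt (X : FMap n ℝ) (p q : Fin 3) (i j : Fin n) :
    MvPowerSeries (Fin 3 × Fin n) ℝ := atPts ![p, q] (coboundary φ X i j)

/-- The part of `{{X^i(u_p), X^j(u_q)}, X^k(u_r)}` in which the outer bracket involves
`X(u_p)`. -/
def halfBracket (X : FMap n ℝ) (p q r : Fin 3) (i j k : Fin n) : MvPowerSeries (Fin 3 × Fin n) ℝ :=
  (∑ a, ∑ b, pderiv ℝ (p, a) (coboundaryAt φ X p r i k) * atPt q (jac X j b) * phiAt φ p q a b) -
    ∑ s, pullback X (pderiv ℝ (p, s) (phiAt φ p q i j)) * coboundaryAt φ X p r s k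

/-- One third of the positive part of the cubic expression `Φ`. -/
def halfPhi (p q r : Fin 3) (i j k : Fin n) : MvPowerSeries (Fin 3 × Fin n) ℝ :=
  ∑ s, phiAt φ p q s j * pderiv ℝ (p, s) (phiAt φ p r i k)

/-- The double bracket of the coboundary tensor as a series. -/
def doubleBracketSeries (X : FMap n ℝ) : Tensor3 n ℝ := fun i j k =>
  halfBracket φ X 0 1 2 i j k - halfBracket φ X 1 0 2 j i k

variable {φ}

theorem phiAt_skew (hφ : IsSkew φ) (p q : Fin 3) (i j : Fin n) :
    phiAt φ p q i j = -phiAt φ q p j i := by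
  have hv : (![p, q] : Fin 2 → Fin 3) ∘ ![1, 0] = ![q, p] := by
    ext x
    fin_cases x <;> rfl
  rw [phiAt, hφ i j, atPts_neg, atPts_atPts, hv]

/-- Skewness groups the six terms in pairs according to the point of differentiation, the same
grouping as for the half brackets. -/
theorem Phi_eq (hφ : IsSkew φ) (i j k : Fin n) :
    Phi φ i j k = (halfPhi φ 0 1 2 i j k - halfPhi φ 0 2 1 i k j) +
      (halfPhi φ 1 2 0 j k i - halfPhi φ 1 0 2 j i k) +
      (halfPhi φ 2 0 1 k i j - halfPhi φ 2 1 0 k j i) := by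
  simp only [Phi, halfPhi, ← Finset.sum_sub_distrib, ← Finset.sum_add_distrib]
  refine Finset.sum_congr rfl fun s _ => ?_
  have h1 := phiAt_skew hφ 2 0 k s
  have h2 := phiAt_skew hφ 0 1 i s
  have h3 := phiAt_skew hφ 1 2 j s
  simp only [phiAt] at *
  rw [h1, h2, h3]
  ring

theorem coboundaryAt_eq {X : FMap n ℝ} (hX : IsSubstitutable X) (p q : Fin 3) (i j : Fin n) :
    coboundaryAt φ X p q i j =
      (∑ k, ∑ l, atPt p (jac X i k) * atPt q (jac X j l) * phiAt φ p q k l) -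
        pullback X (phiAt φ p q i j) := by
  simp only [coboundaryAt, coboundary_eq, atPts_sub, atPts_sum, atPts_mul, atPts_atPt,
    atPts_pullback hX, phiAt]
  rfl

theorem pderiv_coboundaryAt {X : FMap n ℝ} (hX : IsSubstitutable X) {p r : Fin 3} (h : p ≠ r)
    (i k a : Fin n) :
    pderiv ℝ (p, a) (coboundaryAt φ X p r i k) =
      (∑ c, ∑ d, (atPt p (pderiv ℝ a (jac X i c)) * atPt r (jac X k d) * phiAt φ p r c d +
        atPt p (jac X i c) * atPt r (jac X k d) * pderiv ℝ (p, a) (phiAt φ p r c d))) -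
        ∑ s, pullback X (pderiv ℝ (p, s) (phiAt φ p r i k)) * atPt p (jac X s a) := by
  rw [coboundaryAt_eq hX, map_sub, pderiv_pullback hX, map_sum]
  congr 1
  refine Finset.sum_congr rfl fun c _ => ?_
  rw [map_sum]
  refine Finset.sum_congr rfl fun d _ => ?_
  rw [Derivation.leibniz, Derivation.leibniz, pderiv_atPt, pderiv_atPt_of_ne h.symm]
  simp only [smul_eq_mul]
  ring

/-- Expansion of `halfBracket`, with the sums in abstract form. -/
theorem sum_identity {ι A : Type*} [Fintype ι] [CommRing A] (H Jp : ι → ι → A)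
    (Ji Jj Jk P Q : ι → A) (K F : ι → ι → A) (D : ι → ι → ι → A) (Pq : ι → A) :
    (∑ a, ∑ b, ((∑ c, ∑ d, (H c a * Jk d * F c d + Ji c * Jk d * D a c d)) -
        ∑ s, Q s * Jp s a) * Jj b * K a b) -
      ∑ s, P s * ((∑ c, ∑ d, Jp s c * Jk d * F c d) - Pq s) =
    (∑ a, ∑ b, ∑ c, ∑ d, H c a * Jk d * F c d * Jj b * K a b) +
      (∑ c, ∑ b, ∑ d, Ji c * Jj b * Jk d * ∑ a, K a b * D a c d) -
      (∑ s, ∑ a, ∑ b, Q s * Jp s a * Jj b * K a b) -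
      (∑ s, ∑ c, ∑ d, P s * Jp s c * Jk d * F c d) + ∑ s, P s * Pq s := by
  have h2 : ∑ c, ∑ b, ∑ d, Ji c * Jj b * Jk d * ∑ a, K a b * D a c d =
      ∑ a, ∑ b, ∑ c, ∑ d, Ji c * Jk d * D a c d * Jj b * K a b := by
    simp only [Finset.mul_sum, ← Fintype.sum_prod_type']
    refine Fintype.sum_equiv
      ⟨fun x => (x.2.2.2, x.2.1, x.1, x.2.2.1), fun x => (x.2.2.1, x.2.1, x.2.2.2, x.1),
        fun _ => rfl, fun _ => rfl⟩ _ _ fun x => ?_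
    simp only [Equiv.coe_fn_mk]
    ring
  have h3 : ∑ s, ∑ a, ∑ b, Q s * Jp s a * Jj b * K a b =
      ∑ a, ∑ b, ∑ s, Q s * Jp s a * Jj b * K a b := by
    rw [Finset.sum_comm]
    exact Finset.sum_congr rfl fun a _ => Finset.sum_comm
  rw [h2, h3]
  simp only [sub_mul, add_mul, mul_sub, Finset.sum_mul, Finset.mul_sum, Finset.sum_add_distrib,
    Finset.sum_sub_distrib, mul_assoc]
  ring

/-- Only this antisymmetrisation in `(q,j)` and `(r,k)` is tractable: a single half bracket still
contains second derivatives of `X` and terms mixing `J` with pullbacks. -/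
theorem halfBracket_sub {X : FMap n ℝ} (hX : IsSubstitutable X) {p q r : Fin 3} (hq : p ≠ q)
    (hr : p ≠ r) (i j k : Fin n) :
    halfBracket φ X p q r i j k - halfBracket φ X p r q i k j =
      (∑ c, ∑ b, ∑ d, atPt p (jac X i c) * atPt q (jac X j b) * atPt r (jac X k d) *
        (halfPhi φ p q r c b d - halfPhi φ p r q c d b)) -
      pullback X (halfPhi φ p q r i j k - halfPhi φ p r q i k j) := by
  simp only [halfBracket, pderiv_coboundaryAt hX hr, pderiv_coboundaryAt hX hq]
  simp only [coboundaryAt_eq hX]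
  rw [sum_identity, sum_identity]
  -- The second-derivative terms agree after exchanging `(a,b)` with `(c,d)`, because `∂_a ∂_c X^i =
  -- ∂_c ∂_a X^i`.
  have h1 : (∑ a, ∑ b, ∑ c, ∑ d, atPt p (pderiv ℝ a (jac X i c)) * atPt q (jac X j d) *
      phiAt φ p q c d * atPt r (jac X k b) * phiAt φ p r a b) =
      ∑ a, ∑ b, ∑ c, ∑ d, atPt p (pderiv ℝ a (jac X i c)) * atPt r (jac X k d) *
      phiAt φ p r c d * atPt q (jac X j b) * phiAt φ p q a b := by
    simp only [← Fintype.sum_prod_type']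
    refine Fintype.sum_equiv
      ⟨fun x => (x.2.2.1, x.2.2.2, x.1, x.2.1), fun x => (x.2.2.1, x.2.2.2, x.1, x.2.1),
        fun _ => rfl, fun _ => rfl⟩ _ _ fun x => ?_
    simp only [Equiv.coe_fn_mk, jac]
    rw [pderiv_comm]
    ring
  have h2 : (∑ c, ∑ b, ∑ d, atPt p (jac X i c) * atPt r (jac X k b) * atPt q (jac X j d) *
      ∑ a, phiAt φ p r a b * pderiv ℝ (p, a) (phiAt φ p q c d)) =
      ∑ c, ∑ b, ∑ d, atPt p (jac X i c) * atPt q (jac X j b) * atPt r (jac X k d) *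
        halfPhi φ p r q c d b := by
    refine Finset.sum_congr rfl fun c _ => ?_
    rw [Finset.sum_comm]
    refine Finset.sum_congr rfl fun b _ => Finset.sum_congr rfl fun d _ => ?_
    rw [halfPhi]
    ring
  rw [h1, h2]
  simp only [pullback_sub hX, mul_sub, Finset.sum_sub_distrib]
  simp only [halfPhi, pullback_sum hX, pullback_mul hX]
  -- Fixes the order of factors under the sums, so that `ring` recognises the pulled-back products
  -- on both sides; it also cancels the mixed terms, each occurring once in either half bracket.
  simp only [mul_comm (pullback X (phiAt φ _ _ _ _))]
  ring

/-- Differentiation at one point survives a relabelling only if no two points are identified, hence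
the injectivity; it is applied to the two cyclic permutations in `cyclicSum`. -/
theorem atPts_halfBracket {X : FMap n ℝ} (hX : IsSubstitutable X) {c : Fin 3 → Fin 3}
    (hc : Function.Injective c) (p q r : Fin 3) (i j k : Fin n) :
    atPts c (halfBracket φ X p q r i j k) = halfBracket φ X (c p) (c q) (c r) i j k := by
  have hv : ∀ x y : Fin 3, c ∘ ![x, y] = ![c x, c y] := by
    intro x y
    ext z
    fin_cases z <;> rfl
  simp only [halfBracket, atPts_sub, atPts_sum, atPts_mul, atPts_atPt, ← pderiv_atPts hc,
    atPts_pullback hX, atPts_atPts, hv, coboundaryAt, phiAt]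

/-- The Jacobi expression of the coboundary tensor measures the failure of `Φ` to be
invariant. -/
theorem cyclicSum_doubleBracketSeries (hφ : IsSkew φ) {X : FMap n ℝ} (hX : IsSubstitutable X)
    (i j k : Fin n) :
    cyclicSum (doubleBracketSeries φ X) i j k =
      (∑ s, ∑ q, ∑ t, atPt 0 (jac X i s) * atPt 1 (jac X j q) * atPt 2 (jac X k t) *
        Phi φ s q t) - pullback X (Phi φ i j k) := by
  have hA : Function.Injective (![2, 0, 1] : Fin 3 → Fin 3) := by decide
  have hB : Function.Injective (![1, 2, 0] : Fin 3 → Fin 3) := by decide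
  simp only [cyclicSum, doubleBracketSeries, atPts_sub, atPts_halfBracket hX hA,
    atPts_halfBracket hX hB]
  have h0 := halfBracket_sub (φ := φ) hX (p := 0) (q := 1) (r := 2) (by decide) (by decide) i j k
  have h1 := halfBracket_sub (φ := φ) hX (p := 1) (q := 2) (r := 0) (by decide) (by decide) j k i
  have h2 := halfBracket_sub (φ := φ) hX (p := 2) (q := 0) (r := 1) (by decide) (by decide) k i j
  -- `e1` and `e2` relabel the summation indices so that all three pairs carry the Jacobians in the
  -- order `u, v, w`.
  have e1 : ∀ F : Fin n → Fin n → Fin n → MvPowerSeries (Fin 3 × Fin n) ℝ,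
      (∑ c, ∑ b, ∑ d, atPt 1 (jac X j c) * atPt 2 (jac X k b) * atPt 0 (jac X i d) * F c b d) =
      ∑ s, ∑ q, ∑ t, atPt 0 (jac X i s) * atPt 1 (jac X j q) * atPt 2 (jac X k t) * F q t s := by
    intro F
    simp only [← Fintype.sum_prod_type']
    refine Fintype.sum_equiv ⟨fun x => (x.2.2, x.1, x.2.1), fun x => (x.2.1, x.2.2, x.1),
        fun _ => rfl, fun _ => rfl⟩ _ _ fun x => ?_
    simp only [Equiv.coe_fn_mk]
    ring
  have e2 : ∀ F : Fin n → Fin n → Fin n → MvPowerSeries (Fin 3 × Fin n) ℝ,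
      (∑ c, ∑ b, ∑ d, atPt 2 (jac X k c) * atPt 0 (jac X i b) * atPt 1 (jac X j d) * F c b d) =
      ∑ s, ∑ q, ∑ t, atPt 0 (jac X i s) * atPt 1 (jac X j q) * atPt 2 (jac X k t) * F t s q := by
    intro F
    simp only [← Fintype.sum_prod_type']
    refine Fintype.sum_equiv ⟨fun x => (x.2.1, x.2.2, x.1), fun x => (x.2.2, x.1, x.2.1),
        fun _ => rfl, fun _ => rfl⟩ _ _ fun x => ?_
    simp only [Equiv.coe_fn_mk]
    ring
  rw [e1 fun c b d => halfPhi φ 1 2 0 c b d - halfPhi φ 1 0 2 c d b] at h1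
  rw [e2 fun c b d => halfPhi φ 2 0 1 c b d - halfPhi φ 2 1 0 c d b] at h2
  simp only [Phi_eq hφ, pullback_add hX, mul_add, Finset.sum_add_distrib]
  simp only [Matrix.cons_val_zero, Matrix.cons_val_one, Matrix.cons_val]
  linear_combination h0 + h1 + h2

end Jacobi

/-! ### Exponents and coefficients at several points -/

section Exponents

variable {n : ℕ}

@[simp]
theorem pairExp_zero_apply (a b : Fin n →₀ ℕ) (s : Fin n) : pairExp a b (0, s) = a s := by
  rw [pairExp, Finsupp.add_apply, Finsupp.mapDomain_apply (Prod.mk_right_injective _),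
    Finsupp.mapDomain_of_notMem_range, add_zero]
  simp

@[simp]
theorem pairExp_one_apply (a b : Fin n →₀ ℕ) (s : Fin n) : pairExp a b (1, s) = b s := by
  rw [pairExp, Finsupp.add_apply, Finsupp.mapDomain_apply (Prod.mk_right_injective _),
    Finsupp.mapDomain_of_notMem_range, zero_add]
  simp

theorem pairExp_curry (x : Fin 2 × Fin n →₀ ℕ) : pairExp (x.curry 0) (x.curry 1) = x := by
  ext ⟨p, s⟩
  fin_cases p <;> simp [Finsupp.curry_apply]

theorem pairExp_inj {a b a' b' : Fin n →₀ ℕ} : pairExp a b = pairExp a' b' ↔ a = a' ∧ b = b' := by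
  refine ⟨fun h => ⟨?_, ?_⟩, by rintro ⟨rfl, rfl⟩; rfl⟩
  · ext s; simpa using DFunLike.congr_fun h (0, s)
  · ext s; simpa using DFunLike.congr_fun h (1, s)

/-- The embedding of the variables at two distinct points out of `m`. -/
def ptsEmb {m l : ℕ} (c : Fin l ↪ Fin m) : Fin l × Fin n ↪ Fin m × Fin n :=
  c.prodMap (Function.Embedding.refl _)

theorem coeff_pairExp_swap (a b : Fin n →₀ ℕ) (f : MvPowerSeries (Fin 2 × Fin n) ℝ) :
    coeff (pairExp a b) (atPts ![1, 0] f) = coeff (pairExp b a) f := by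
  let c : Fin 2 ↪ Fin 2 := ⟨![1, 0], by decide⟩
  have h : pairExp a b = Finsupp.embDomain (ptsEmb c) (pairExp b a) := by
    ext ⟨p, s⟩
    have h0 : ((0 : Fin 2), s) = ptsEmb c (1, s) := rfl
    have h1 : ((1 : Fin 2), s) = ptsEmb c (0, s) := rfl
    fin_cases p
    · simp only [Fin.zero_eta, pairExp_zero_apply]
      rw [h0, Finsupp.embDomain_apply_self, pairExp_one_apply]
    · simp only [Fin.mk_one, pairExp_one_apply]
      rw [h1, Finsupp.embDomain_apply_self, pairExp_zero_apply]
  rw [h]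
  exact coeff_embDomain_rename (ptsEmb c) f _

/-- Among the monomials `w^d`, only the one with the `w`-exponent of `e` contributes; this reduces a
sum over pairs of exponents to a sum over one. -/
theorem coeff_atPts_mul_atPt_monomial (G : MvPowerSeries (Fin 2 × Fin n) ℝ) (d : Fin n →₀ ℕ)
    (e : Fin 3 × Fin n →₀ ℕ) [Decidable (d = e.curry 2)] :
    coeff e (atPts ![0, 1] G * atPt 2 (monomial d 1)) =
      if d = e.curry 2 then coeff (pairExp (e.curry 0) (e.curry 1)) G else 0 := by
  classical
  let c : Fin 2 ↪ Fin 3 := ⟨![0, 1], by decide⟩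
  have hr : ∀ s : Fin n, ((2 : Fin 3), s) ∉ Set.range (ptsEmb (n := n) c) := by
    rintro s ⟨⟨p, t⟩, h⟩
    have h' : c p = 2 := congrArg Prod.fst h
    revert h'
    fin_cases p <;> decide
  have hm : atPt (2 : Fin 3) (monomial d (1 : ℝ)) =
      monomial (d.mapDomain fun s => ((2 : Fin 3), s)) 1 := rename_monomial _ _ _
  rw [hm]
  split_ifs with h
  · have he : e = Finsupp.embDomain (ptsEmb c) (pairExp (e.curry 0) (e.curry 1)) +
        d.mapDomain fun s => ((2 : Fin 3), s) := by
      ext ⟨p, s⟩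
      have h0 : ((0 : Fin 3), s) = ptsEmb c (0, s) := rfl
      have h1 : ((1 : Fin 3), s) = ptsEmb c (1, s) := rfl
      rw [Finsupp.add_apply]
      fin_cases p
      · simp only [Fin.zero_eta]
        rw [Finsupp.mapDomain_of_notMem_range _ _ (by simp), h0, Finsupp.embDomain_apply_self,
          pairExp_zero_apply, add_zero]
        rfl
      · simp only [Fin.mk_one]
        rw [Finsupp.mapDomain_of_notMem_range _ _ (by simp), h1, Finsupp.embDomain_apply_self,
          pairExp_one_apply, add_zero]
        rfl
      · simp only [Fin.reduceFinMk]
        rw [Finsupp.mapDomain_apply (Prod.mk_right_injective _),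
          Finsupp.embDomain_of_notMem_range _ _ _ (hr s), zero_add, h]
        rfl
    conv_lhs => rw [he]
    rw [coeff_add_mul_monomial, mul_one]
    exact coeff_embDomain_rename (ptsEmb c) G _
  · rw [coeff_mul_monomial]
    split_ifs with hle
    · rw [mul_one]
      refine coeff_rename_eq_zero (ptsEmb c) G ?_
      rintro ⟨x, hx⟩
      refine h (Finsupp.ext fun s => ?_)
      have h2 := DFunLike.congr_fun hx ((2 : Fin 3), s)
      have h3 := hle ((2 : Fin 3), s)
      rw [Finsupp.mapDomain_of_notMem_range _ _ (hr s), Finsupp.tsub_apply,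
        Finsupp.mapDomain_apply (Prod.mk_right_injective _)] at h2
      rw [Finsupp.mapDomain_apply (Prod.mk_right_injective _)] at h3
      rw [Finsupp.curry_apply]
      omega
    · rfl

theorem atPts_monomial_pairExp {m : ℕ} (p r : Fin m) (c d : Fin n →₀ ℕ) :
    atPts ![p, r] (monomial (pairExp c d) (1 : ℝ)) =
      atPt p (monomial c 1) * atPt r (monomial d 1) := by
  rw [atPts, atPt, atPt, rename_monomial, rename_monomial, rename_monomial,
    monomial_mul_monomial, mul_one, pairExp, Finsupp.mapDomain_add, ← Finsupp.mapDomain_comp,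
    ← Finsupp.mapDomain_comp]
  rfl

end Exponents

/-! ### First order variations over the dual numbers -/

section Dual

open TrivSqZeroExt

variable {τ υ : Type*} {n m : ℕ}

/-- The coefficient of `ε` in a series over the dual numbers. -/
def sndCoeff : MvPowerSeries τ (DualNumber ℝ) →ₗ[ℝ] MvPowerSeries τ ℝ where
  toFun f := fun d => (coeff d f).snd
  map_add' _ _ := rfl
  map_smul' _ _ := rfl

/-- The reduction of a series over the dual numbers modulo `ε`. -/
abbrev fstCoeff : MvPowerSeries τ (DualNumber ℝ) →ₐ[ℝ] MvPowerSeries τ ℝ :=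
  mapAlgHom (fstHom ℝ ℝ ℝ)

theorem coeff_sndCoeff (f : MvPowerSeries τ (DualNumber ℝ)) (d : τ →₀ ℕ) :
    coeff d (sndCoeff f) = (coeff d f).snd := rfl

theorem coeff_fstCoeff (f : MvPowerSeries τ (DualNumber ℝ)) (d : τ →₀ ℕ) :
    coeff d (fstCoeff f) = (coeff d f).fst := rfl

theorem sndCoeff_mul (f g : MvPowerSeries τ (DualNumber ℝ)) :
    sndCoeff (f * g) = fstCoeff f * sndCoeff g + fstCoeff g * sndCoeff f := by
  classical
  ext d
  rw [map_add, coeff_sndCoeff, mul_comm (fstCoeff g), coeff_mul, coeff_mul, coeff_mul, snd_sum,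
    ← Finset.sum_add_distrib]
  refine Finset.sum_congr rfl fun p _ => ?_
  rw [snd_mul, coeff_sndCoeff, coeff_sndCoeff, coeff_fstCoeff, coeff_fstCoeff, smul_eq_mul,
    MulOpposite.smul_eq_mul_unop, MulOpposite.unop_op]

theorem sndCoeff_rename (g : τ → υ) [Filter.TendstoCofinite g]
    (f : MvPowerSeries τ (DualNumber ℝ)) : sndCoeff (rename g f) = rename g (sndCoeff f) := by
  ext d
  rw [coeff_sndCoeff, coeff_rename, coeff_rename, snd_sum]
  rfl

theorem sndCoeff_pderiv (k : τ) (f : MvPowerSeries τ (DualNumber ℝ)) :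
    sndCoeff (pderiv (DualNumber ℝ) k f) = pderiv ℝ k (sndCoeff f) := by
  ext d
  rw [coeff_sndCoeff, coeff_pderiv, coeff_pderiv, coeff_sndCoeff]
  simp [snd_mul, mul_comm]

theorem sndCoeff_map (f : MvPowerSeries τ ℝ) :
    sndCoeff (MvPowerSeries.map (algebraMap ℝ (DualNumber ℝ)) f) = 0 := by
  ext d
  rw [coeff_sndCoeff, coeff_map]
  rfl

theorem fstCoeff_map (f : MvPowerSeries τ ℝ) :
    fstCoeff (MvPowerSeries.map (algebraMap ℝ (DualNumber ℝ)) f) = f := by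
  ext d
  rw [coeff_fstCoeff, coeff_map]
  rfl

theorem coeffCont_sndCoeff : CoeffCont (sndCoeff (τ := τ)) :=
  .of fun e => ⟨{e}, fun f hf => by
    rw [coeff_sndCoeff, hf e (Finset.mem_singleton_self e), snd_zero]⟩

theorem sndCoeff_atPt (p : Fin m) (f : MvPowerSeries (Fin n) (DualNumber ℝ)) :
    sndCoeff (atPt p f) = atPt p (sndCoeff f) := sndCoeff_rename _ f

theorem fstCoeff_atPt (p : Fin m) (f : MvPowerSeries (Fin n) (DualNumber ℝ)) :
    fstCoeff (atPt p f) = atPt p (fstCoeff f) := map_atPt _ p f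

theorem fstCoeff_jac (X : FMap n (DualNumber ℝ)) (i k : Fin n) :
    fstCoeff (jac X i k) = jac (fun i => fstCoeff (X i)) i k := map_jac _ X i k

theorem sndCoeff_pullback {X : FMap n (DualNumber ℝ)} (hX : IsSubstitutable X)
    (f : MvPowerSeries (Fin m × Fin n) ℝ) :
    sndCoeff (pullback X f) = ∑ p, ∑ s, pullback (fun i => fstCoeff (X i)) (pderiv ℝ (p, s) f) *
      atPt p (sndCoeff (X s)) := by
  -- Taking the coefficient of `ε` is a derivation along reduction modulo `ε`, so the general chain
  -- rule applies.
  rw [pullback, leibniz_subst fstCoeff sndCoeff sndCoeff_mul (coeffCont_map _) coeffCont_sndCoeff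
    (hX.hasSubst_atPt m), Fintype.sum_prod_type]
  refine Finset.sum_congr rfl fun p _ => Finset.sum_congr rfl fun s _ => ?_
  rw [sndCoeff_atPt]
  congr 1
  exact map_pullback hX (fstHom ℝ ℝ ℝ) _

/-- The first order variation of the coboundary tensor. -/
theorem sndCoeff_coboundary (φ : Tensor2 n ℝ) {X : FMap n (DualNumber ℝ)}
    (hX : IsSubstitutable X) (i j : Fin n) :
    sndCoeff (coboundary φ X i j) =
      (∑ a, ∑ b, (atPt 0 (pderiv ℝ a (sndCoeff (X i))) *
          atPt 1 (jac (fun i => fstCoeff (X i)) j b) +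
        atPt 0 (jac (fun i => fstCoeff (X i)) i a) * atPt 1 (pderiv ℝ b (sndCoeff (X j)))) *
          φ a b) -
      (∑ s, pullback (fun i => fstCoeff (X i)) (pderiv ℝ (0, s) (φ i j)) *
        atPt 0 (sndCoeff (X s))) -
      ∑ s, pullback (fun i => fstCoeff (X i)) (pderiv ℝ (1, s) (φ i j)) *
        atPt 1 (sndCoeff (X s)) := by
  rw [coboundary, map_sub, sndCoeff_pullback hX, Fin.sum_univ_two, ← sub_sub, map_sum]
  congr 2
  refine Finset.sum_congr rfl fun a _ => ?_
  rw [map_sum]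
  refine Finset.sum_congr rfl fun b _ => ?_
  rw [sndCoeff_mul, sndCoeff_map, fstCoeff_map, sndCoeff_mul, sndCoeff_atPt, sndCoeff_atPt,
    fstCoeff_atPt, fstCoeff_atPt, fstCoeff_jac, fstCoeff_jac, jac, sndCoeff_pderiv, jac,
    sndCoeff_pderiv]
  ring

theorem fstCoeff_perturb (X : FMap n ℝ) (s : Fin n) (a : Fin n →₀ ℕ) (i : Fin n) :
    fstCoeff (perturb X s a i) = X i := by
  classical
  rw [perturb, map_add, fstCoeff_map]
  ext d
  rw [map_add, coeff_fstCoeff, add_eq_left]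
  obtain rfl | h := eq_or_ne i s
  · rw [Pi.single_eq_same, coeff_monomial]
    split_ifs <;> simp
  · rw [Pi.single_eq_of_ne h]
    simp

theorem sndCoeff_perturb (X : FMap n ℝ) (s : Fin n) (a : Fin n →₀ ℕ) (i : Fin n) :
    sndCoeff (perturb X s a i) =
      Pi.single (M := fun _ => MvPowerSeries (Fin n) ℝ) s (monomial a 1) i := by
  classical
  rw [perturb, map_add, sndCoeff_map, zero_add]
  ext d
  rw [coeff_sndCoeff]
  obtain rfl | h := eq_or_ne i s
  · rw [Pi.single_eq_same, Pi.single_eq_same, coeff_monomial, coeff_monomial]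
    split_ifs <;> simp
  · rw [Pi.single_eq_of_ne h, Pi.single_eq_of_ne h]
    simp

/-- When `a = 0` the constant term of the `s`-th component is `ε`: not zero, but of square zero.
This is why `IsSubstitutable` asks only for nilpotence. -/
theorem isSubstitutable_perturb {X : FMap n ℝ} (hX : X ∈ G0 n) (s : Fin n) (a : Fin n →₀ ℕ) :
    IsSubstitutable (perturb X s a) := by
  intro i
  refine ⟨2, ?_⟩
  have h1 : (constantCoeff (perturb X s a i)).fst = 0 := by
    rw [← coeff_zero_eq_constantCoeff_apply, ← coeff_fstCoeff, fstCoeff_perturb,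
      coeff_zero_eq_constantCoeff_apply, hX.1 i]
  ext <;> simp [pow_two, h1]

end Dual

/-! ### The double bracket as a series -/

section Series

variable {n : ℕ} {σ τ : Type*}

/-- A coefficientwise finite linear map is the sum of its values on monomials. -/
theorem coeff_eq_finsum (L : (Fin n → MvPowerSeries σ ℝ) →ₗ[ℝ] MvPowerSeries τ ℝ)
    (hL : CoeffFinite (fun (c : Fin n × (σ →₀ ℕ)) W => coeff c.2 (W c.1)) L)
    (e : τ →₀ ℕ) (W : Fin n → MvPowerSeries σ ℝ) :
    coeff e (L W) = ∑ᶠ c : Fin n × (σ →₀ ℕ),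
      coeff e (L (Pi.single c.1 (monomial c.2 1))) * coeff c.2 (W c.1) := by
  classical
  obtain ⟨T, hT⟩ := hL e
  let E : Fin n × (σ →₀ ℕ) → Fin n → MvPowerSeries σ ℝ :=
    fun c => Pi.single c.1 (monomial c.2 1)
  have hco : ∀ c c', coeff c'.2 (E c c'.1) = if c' = c then 1 else 0 := by
    simp only [E]
    rintro ⟨s, d⟩ ⟨s', d'⟩
    obtain rfl | h := eq_or_ne s' s
    · simp [coeff_monomial]
    · simp [h]
  change _ = ∑ᶠ c, coeff e (L (E c)) * coeff c.2 (W c.1)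
  rw [finsum_eq_sum_of_support_subset (s := T)]
  · have h0 := hT (W - ∑ c ∈ T, coeff c.2 (W c.1) • E c) fun c hc => by
      simp only [Pi.sub_apply, Finset.sum_apply, Pi.smul_apply, map_sub, map_sum]
      rw [Finset.sum_eq_single_of_mem c hc]
      · rw [map_smul, hco]; simp
      · intro b _ hb
        rw [map_smul, hco, if_neg hb.symm, smul_zero]
    rw [map_sub, map_sub, sub_eq_zero] at h0
    rw [h0, map_sum, map_sum]
    refine Finset.sum_congr rfl fun c _ => ?_
    rw [map_smul, map_smul, smul_eq_mul, mul_comm]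
  · intro c hc
    by_contra hcT
    refine hc ?_
    dsimp only
    rw [hT _ fun c' hc' => ?_, zero_mul]
    exact (hco c c').trans (if_neg (by rintro rfl; exact hcT hc'))

/-- The linear map underlying `halfBracket`. -/
def halfVariation (φ : Tensor2 n ℝ) (X : FMap n ℝ) (p q r : Fin 3) (i j : Fin n) :
    (Fin n → MvPowerSeries (Fin 2 × Fin n) ℝ) →ₗ[ℝ] MvPowerSeries (Fin 3 × Fin n) ℝ where
  toFun W :=
    (∑ a, ∑ b, pderiv ℝ (p, a) (atPts ![p, r] (W i)) * atPt q (jac X j b) * phiAt φ p q a b) -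
      ∑ s, pullback X (pderiv ℝ (p, s) (phiAt φ p q i j)) * atPts ![p, r] (W s)
  map_add' W W' := by
    simp only [Pi.add_apply, atPts_add, map_add, mul_add, add_mul, Finset.sum_add_distrib]
    ring
  map_smul' t W := by
    simp only [Pi.smul_apply, atPts, map_smul, Derivation.map_smul, smul_mul_assoc, mul_smul_comm, ← Finset.smul_sum,
      smul_sub, RingHom.id_apply]

theorem coeffFinite_halfVariation (φ : Tensor2 n ℝ) (X : FMap n ℝ) (p q r : Fin 3)
    (i j : Fin n) :
    CoeffFinite (fun (c : Fin n × (Fin 2 × Fin n →₀ ℕ)) W => coeff c.2 (W c.1))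
      (halfVariation φ X p q r i j) := by
  have h : ∀ s, CoeffFinite (fun (c : Fin n × (Fin 2 × Fin n →₀ ℕ)) W => coeff c.2 (W c.1))
      fun W : Fin n → MvPowerSeries (Fin 2 × Fin n) ℝ => atPts ![p, r] (W s) := fun s =>
    (coeffCont_rename _).comp_coeffFinite fun e =>
      ⟨{(s, e)}, fun W hW => hW (s, e) (Finset.mem_singleton_self _)⟩
  exact .sub (.sum _ fun a => .sum _ fun b =>
    (((coeffCont_pderiv _).comp_coeffFinite (h i)).mul_const _).mul_const _)
    (.sum _ fun s => (h s).const_mul _)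

/-- For a direction `V(u_p) M(u_r)` the point `u_r` is a mere parameter: derivatives at `u_p` do not
touch `M`, which factors out. -/
theorem halfVariation_of_mul (φ : Tensor2 n ℝ) (X : FMap n ℝ) {p q r : Fin 3} (h : p ≠ r)
    (i j : Fin n) {W : Fin n → MvPowerSeries (Fin 2 × Fin n) ℝ} {V : FMap n ℝ}
    {M : MvPowerSeries (Fin n) ℝ} (hW : ∀ t, atPts ![p, r] (W t) = atPt p (V t) * atPt r M) :
    halfVariation φ X p q r i j W =
      ((∑ a, ∑ b, atPt p (pderiv ℝ a (V i)) * atPt q (jac X j b) * phiAt φ p q a b) -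
        ∑ t, pullback X (pderiv ℝ (p, t) (phiAt φ p q i j)) * atPt p (V t)) * atPt r M := by
  rw [halfVariation, LinearMap.coe_mk, AddHom.coe_mk, sub_mul, Finset.sum_mul, Finset.sum_mul]
  refine congrArg₂ (· - ·) (Finset.sum_congr rfl fun a _ => ?_)
    (Finset.sum_congr rfl fun t _ => ?_)
  · rw [Finset.sum_mul]
    refine Finset.sum_congr rfl fun b _ => ?_
    rw [hW, Derivation.leibniz, pderiv_atPt, pderiv_atPt_of_ne h.symm, smul_zero, zero_add,
      smul_eq_mul]
    ring
  · rw [hW, mul_assoc]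

theorem atPts_single_monomial {m : ℕ} (p r : Fin m) (s t : Fin n) (c d : Fin n →₀ ℕ) :
    atPts ![p, r] ((Pi.single s (monomial (pairExp c d) 1) :
        Fin n → MvPowerSeries (Fin 2 × Fin n) ℝ) t) =
      atPt p (Pi.single (M := fun _ => MvPowerSeries (Fin n) ℝ) s (monomial c 1) t) *
        atPt r (monomial d 1) := by
  obtain rfl | ht := eq_or_ne t s
  · rw [Pi.single_eq_same, Pi.single_eq_same, atPts_monomial_pairExp]
  · rw [Pi.single_eq_of_ne ht, Pi.single_eq_of_ne ht, atPts, atPt, map_zero, map_zero, zero_mul]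

theorem formalDoubleBracket_eq {φ : Tensor2 n ℝ} (hφ : IsSkew φ) {X : FMap n ℝ} (hX : X ∈ G0 n) :
    formalDoubleBracket φ X = doubleBracketSeries φ X := by
  classical
  have hX' := isSubstitutable_of_mem hX
  funext i j k
  ext e
  -- The derivative of `Ω^{ij}` at `X` in a direction depending on the extra point `w`.
  let L := halfVariation φ X 0 1 2 i j - halfVariation φ X 1 0 2 j i
  have hL : doubleBracketSeries φ X i j k = L fun s => coboundary φ X s k := rfl
  have hmono : ∀ s c d, L (Pi.single s (monomial (pairExp c d) 1)) =
      atPts ![0, 1] (sndCoeff (coboundary φ (perturb X s c) i j)) * atPt 2 (monomial d 1) := by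
    intro s c d
    rw [LinearMap.sub_apply,
      halfVariation_of_mul φ X (by decide) i j fun t => atPts_single_monomial 0 2 s t c d,
      halfVariation_of_mul φ X (by decide) j i fun t => atPts_single_monomial 1 2 s t c d,
      ← sub_mul, sndCoeff_coboundary φ (isSubstitutable_perturb hX s c)]
    refine congrArg (· * _) ?_
    simp only [fstCoeff_perturb, sndCoeff_perturb]
    generalize (Pi.single s (monomial c 1) : FMap n ℝ) = V
    have hinj : Function.Injective (![0, 1] : Fin 2 → Fin 3) := by decide
    have hf0 : ∀ t, atPts ![0, 1] (pderiv ℝ (0, t) (φ i j)) =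
        pderiv ℝ ((0 : Fin 3), t) (phiAt φ 0 1 i j) := fun t => (pderiv_atPts hinj 0 t _).symm
    have hf1 : ∀ t, atPts ![0, 1] (pderiv ℝ (1, t) (φ i j)) =
        pderiv ℝ ((1 : Fin 3), t) (phiAt φ 0 1 i j) := fun t => (pderiv_atPts hinj 1 t _).symm
    simp only [atPts_sub, atPts_sum, atPts_mul, atPts_add,
      atPts_atPt, atPts_pullback hX', hf0, hf1, add_mul, Finset.sum_add_distrib,
      Matrix.cons_val_zero, Matrix.cons_val_one]
    -- The second half variation is written with `u` and `v` exchanged; skewness of `φ` restores the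
    -- order and absorbs the minus sign in `L`.
    rw [phiAt_skew hφ 1 0 j i]
    simp only [map_neg, pullback_neg hX', neg_mul, Finset.sum_neg_distrib]
    have hs : ∀ (V : MvPowerSeries (Fin n) ℝ),
        ∑ a, ∑ b, atPt 1 (pderiv ℝ a V) * atPt 0 (jac X i b) * phiAt φ 1 0 a b =
        -∑ a, ∑ b, atPt 0 (jac X i a) * atPt 1 (pderiv ℝ b V) * phiAt φ 0 1 a b := by
      intro V
      rw [Finset.sum_comm]
      simp only [← Finset.sum_neg_distrib]
      refine Finset.sum_congr rfl fun a _ => Finset.sum_congr rfl fun b _ => ?_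
      rw [phiAt_skew hφ 1 0 b a]
      ring
    rw [hs]
    ring
  change formalDoubleBracket φ X i j k e = _
  rw [hL, coeff_eq_finsum L
    ((coeffFinite_halfVariation φ X 0 1 2 i j).sub (coeffFinite_halfVariation φ X 1 0 2 j i)),
    formalDoubleBracket]
  let g : Fin n × (Fin n →₀ ℕ) → Fin n × (Fin 2 × Fin n →₀ ℕ) :=
    fun c => (c.1, pairExp c.2 (e.curry 2))
  have hg : Function.Injective g := by
    rintro ⟨s, c⟩ ⟨s', c'⟩ h
    obtain ⟨h1, h2⟩ := Prod.mk.inj h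
    exact Prod.ext h1 (pairExp_inj.1 h2).1
  symm
  -- The sum over exponents in two points is supported on the range of `g`, where the second
  -- exponent is the `w`-part of `e`.
  rw [← finsum_mem_univ, finsum_mem_inter_support_eq' _ _ (Set.range g), finsum_mem_range hg]
  · refine finsum_congr fun c => ?_
    dsimp only [g]
    rw [hmono, coeff_atPts_mul_atPt_monomial, if_pos rfl, coeff_sndCoeff]
  · rintro ⟨s, x⟩ hx
    refine ⟨fun _ => ⟨(s, x.curry 0), ?_⟩, fun _ => Set.mem_univ _⟩
    by_contra hne
    refine hx ?_
    dsimp only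
    rw [← pairExp_curry x, hmono, coeff_atPts_mul_atPt_monomial, if_neg, zero_mul]
    intro h
    exact hne (by simp only [g]; rw [← h, pairExp_curry])

theorem isFormalJacobi_iff {φ : Tensor2 n ℝ} (hφ : IsSkew φ) :
    IsFormalJacobi φ ↔ IsInvariant (Phi φ) := by
  have h : ∀ X ∈ G0 n, ∀ i j k, cyclicSum (formalDoubleBracket φ X) i j k = 0 ↔
      pullback X (Phi φ i j k) = ∑ s, ∑ q, ∑ t, atPt 0 (jac X i s) * atPt 1 (jac X j q) *
        atPt 2 (jac X k t) * Phi φ s q t := fun X hX i j k => by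
    rw [formalDoubleBracket_eq hφ hX, cyclicSum_doubleBracketSeries hφ (isSubstitutable_of_mem hX),
      sub_eq_zero, eq_comm]
  exact forall₂_congr fun X hX => forall₃_congr fun i j k => h X hX i j k

end Series

/-! ### Smoothness and partial derivatives of the coboundary tensor -/

section Smooth

variable {n : ℕ}

/-- The formal diffeomorphism whose coefficients are the coordinates of the group. -/
def genericMap (n : ℕ) : FMap n (MvPolynomial (Coord n) ℝ) := fun i a =>
  open Classical in if h : a ≠ 0 then MvPolynomial.X (i, ⟨a, h⟩) else 0

theorem isSubstitutable_genericMap : IsSubstitutable (genericMap n) := by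
  intro i
  have : constantCoeff (genericMap n i) = 0 := by
    rw [← coeff_zero_eq_constantCoeff_apply, coeff_apply, genericMap, dif_neg (by simp)]
  rw [this]
  exact IsNilpotent.zero

theorem map_genericMap {X : FMap n ℝ} (hX : X ∈ G0 n) (i : Fin n) :
    MvPowerSeries.map ((MvPolynomial.aeval fun c : Coord n => coeff c.2.1 (X c.1) :
      MvPolynomial (Coord n) ℝ →ₐ[ℝ] ℝ) : MvPolynomial (Coord n) ℝ →+* ℝ) (genericMap n i) =
      X i := by
  ext a
  rw [coeff_map, coeff_apply, genericMap]
  split_ifs with h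
  · simp
  · rw [not_not] at h
    subst h
    simp [hX.1 i]

/-- Each coefficient is a polynomial in finitely many coordinates: it is computed once for
`genericMap` and specialised by `map_coboundary`. -/
theorem isSmooth_coboundary (φ : Tensor2 n ℝ) (i j : Fin n) (e : Fin 2 × Fin n →₀ ℕ) :
    IsSmooth fun X => coeff e (coboundary φ X i j) := by
  obtain ⟨S, q, hq⟩ := MvPolynomial.exists_finset_rename
    (coeff e (coboundary φ (genericMap n) i j))
  refine ⟨S, fun y => MvPolynomial.aeval y q, ?_, fun X hX => ?_⟩
  · have : AnalyticOnNhd ℝ (fun y : S → ℝ => MvPolynomial.aeval y q) Set.univ :=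
      AnalyticOnNhd.aeval_mvPolynomial
        (fun c => (ContinuousLinearMap.proj (R := ℝ) (φ := fun _ : S => ℝ) c).analyticOnNhd _) q
    exact (this.contDiffOn uniqueDiffOn_univ).mono (Set.subset_univ _)
  · have h := map_coboundary isSubstitutable_genericMap
      (MvPolynomial.aeval fun c : Coord n => coeff c.2.1 (X c.1)) φ i j
    simp only [map_genericMap hX] at h
    dsimp only
    rw [← h, coeff_map, hq]
    exact MvPolynomial.aeval_rename _ _ _

/-- The line `X + t u^a` in the `s`-th component, over the polynomial ring in `t`. -/
def linePoly (X : FMap n ℝ) (s : Fin n) (a : Fin n →₀ ℕ) : FMap n (Polynomial ℝ) :=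
  fun i => MvPowerSeries.map (algebraMap ℝ (Polynomial ℝ)) (X i) +
    Pi.single (M := fun _ => MvPowerSeries (Fin n) (Polynomial ℝ)) s (monomial a Polynomial.X) i

theorem isSubstitutable_linePoly {X : FMap n ℝ} (hX : X ∈ G0 n) (s : Fin n) {a : Fin n →₀ ℕ}
    (ha : a ≠ 0) : IsSubstitutable (linePoly X s a) := by
  intro i
  have : constantCoeff (linePoly X s a i) = 0 := by
    rw [linePoly, map_add, constantCoeff_map, hX.1 i, map_zero, zero_add]
    obtain rfl | h := eq_or_ne i s
    · rw [Pi.single_eq_same, ← coeff_zero_eq_constantCoeff_apply, coeff_monomial_ne ha.symm]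
    · rw [Pi.single_eq_of_ne h, map_zero]
  rw [this]
  exact IsNilpotent.zero

theorem map_linePoly {S : Type*} [CommRing S] [Algebra ℝ S] (t : S) (X : FMap n ℝ) (s : Fin n)
    (a : Fin n →₀ ℕ) (i : Fin n) :
    MvPowerSeries.map ((Polynomial.aeval t : Polynomial ℝ →ₐ[ℝ] S) : Polynomial ℝ →+* S)
      (linePoly X s a i) = MvPowerSeries.map (algebraMap ℝ S) (X i) +
        Pi.single (M := fun _ => MvPowerSeries (Fin n) S) s (monomial a t) i := by
  rw [linePoly, map_add, MvPowerSeries.map_map, AlgHom.comp_algebraMap]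
  congr 1
  obtain rfl | h := eq_or_ne i s
  · rw [Pi.single_eq_same, Pi.single_eq_same, map_monomial]
    simp
  · rw [Pi.single_eq_of_ne h, Pi.single_eq_of_ne h, map_zero]

/-- Partial derivatives of the coboundary tensor can be computed over the dual numbers. -/
theorem partialX_coboundary (φ : Tensor2 n ℝ) {X : FMap n ℝ} (hX : X ∈ G0 n) (c : Coord n)
    (i j : Fin n) (e : Fin 2 × Fin n →₀ ℕ) :
    partialX c (fun X' => coeff e (coboundary φ X' i j)) X =
      TrivSqZeroExt.snd (coeff e (coboundary φ (perturb X c.1 c.2.1) i j)) := by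
  -- One polynomial `p` governs both sides: its variable becomes a real `t` for the derivative and
  -- `ε` for the perturbation. The exponent of `c` is nonzero, so the line has no constant term and
  -- can be substituted.
  have hl := isSubstitutable_linePoly hX c.1 c.2.2
  set p := coeff e (coboundary φ (linePoly X c.1 c.2.1) i j) with hp
  have h1 : ∀ t : ℝ, coeff e (coboundary φ (X + Pi.single c.1 (monomial c.2.1 t)) i j) =
      p.eval t := by
    intro t
    have h := map_coboundary hl (Polynomial.aeval t : Polynomial ℝ →ₐ[ℝ] ℝ) φ i j
    simp only [map_linePoly, Algebra.algebraMap_self, MvPowerSeries.map_id, RingHom.id_apply] at h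
    rw [← Polynomial.coe_aeval_eq_eval, hp]
    refine Eq.trans ?_ (congrArg (coeff e) h).symm |>.trans ?_
    · rfl
    · rw [coeff_map]; rfl
  have h2 : coeff e (coboundary φ (perturb X c.1 c.2.1) i j) =
      Polynomial.aeval (DualNumber.eps : DualNumber ℝ) p := by
    have h := map_coboundary hl
      (Polynomial.aeval DualNumber.eps : Polynomial ℝ →ₐ[ℝ] DualNumber ℝ) φ i j
    simp only [map_linePoly] at h
    refine Eq.trans ?_ (congrArg (coeff e) h).symm |>.trans ?_
    · rfl
    · rw [coeff_map]; rfl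
  -- Both sides are `p'(0)`, since `p(ε) = p(0) + p'(0) ε`.
  rw [partialX, funext h1, Polynomial.deriv, h2,
    ← zero_add (DualNumber.eps : DualNumber ℝ),
    Polynomial.aeval_add_of_sq_eq_zero _ _ _ (by simp [pow_two])]
  have h3 : ∀ q : Polynomial ℝ, Polynomial.aeval (0 : DualNumber ℝ) q =
      algebraMap ℝ (DualNumber ℝ) (q.eval 0) := fun q => by
    rw [← map_zero (algebraMap ℝ (DualNumber ℝ)), Polynomial.aeval_algebraMap_apply,
      Polynomial.coe_aeval_eq_eval]
  rw [h3, h3]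
  simp [TrivSqZeroExt.algebraMap_eq_inl, TrivSqZeroExt.snd_mul]

theorem partialX_coeff (X : FMap n ℝ) (c : Coord n) (k : Fin n) (a : Fin n →₀ ℕ)
    [Decidable (k = c.1 ∧ a = c.2.1)] :
    partialX c (fun X' => coeff a (X' k)) X = if k = c.1 ∧ a = c.2.1 then 1 else 0 := by
  classical
  obtain ⟨s, b, hb⟩ := c
  dsimp only
  have h : ∀ t : ℝ, coeff a ((X + Pi.single s (monomial b t) : FMap n ℝ) k) =
      coeff a (X k) + t * if k = s ∧ a = b then 1 else 0 := by
    intro t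
    rw [Pi.add_apply, map_add]
    congr 1
    by_cases hk : k = s
    · subst hk
      rw [Pi.single_eq_same, coeff_monomial]
      split_ifs <;> simp_all
    · rw [Pi.single_eq_of_ne hk]
      simp [hk]
  rw [partialX, funext h]
  by_cases hk : k = s ∧ a = b <;> simp [hk]

end Smooth

/-! ### The coboundary tensor at `u = 0` -/

section AtZero

variable {n : ℕ} {φ : Tensor2 n ℝ}

/-- The variables at the second of two points. -/
def secondPt (n : ℕ) : Fin n ↪ Fin 2 × Fin n :=
  ⟨fun s => (1, s), Prod.mk_right_injective 1⟩

/-- The series `f(0, v)`. -/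
abbrev atZero : MvPowerSeries (Fin 2 × Fin n) ℝ →ₐ[ℝ] MvPowerSeries (Fin n) ℝ :=
  killCompl (secondPt n)

theorem coeff_atZero (f : MvPowerSeries (Fin 2 × Fin n) ℝ) (b : Fin n →₀ ℕ) :
    coeff b (atZero f) = coeff (pairExp 0 b) f := by
  rw [coeff_killCompl, Finsupp.embDomain_eq_mapDomain, pairExp, Finsupp.mapDomain_zero, zero_add]
  rfl

theorem vanishesAtZero_iff : VanishesAtZero φ ↔ ∀ i j, atZero (φ i j) = 0 := by
  refine forall₂_congr fun i j => ⟨fun h => ?_, fun h b => ?_⟩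
  · ext b
    rw [coeff_atZero, h, coeff_zero]
  · rw [← coeff_atZero, h, coeff_zero]

theorem atZero_atPt_one (f : MvPowerSeries (Fin n) ℝ) : atZero (atPt 1 f) = f :=
  killCompl_rename_app f

theorem atZero_atPt_zero (f : MvPowerSeries (Fin n) ℝ) :
    atZero (atPt 0 f) = C (constantCoeff f) := by
  classical
  ext b
  rw [coeff_atZero, coeff_C]
  split_ifs with h
  · have h0 : pairExp (0 : Fin n →₀ ℕ) b = 0 := by
      rw [h, pairExp, Finsupp.mapDomain_zero, Finsupp.mapDomain_zero, add_zero]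
    rw [h0, coeff_zero_eq_constantCoeff_apply, atPt, constantCoeff_rename]
  · refine coeff_rename_eq_zero _ f ?_
    rintro ⟨x, hx⟩
    refine h (Finsupp.ext fun s => ?_)
    have := DFunLike.congr_fun hx (1, s)
    rw [Finsupp.mapDomain_of_notMem_range _ _ (by simp), pairExp_one_apply] at this
    exact this.symm

/-- Since `X` fixes the origin, both composites are algebra homomorphisms killing the first point
and sending the second to `X(v)`. -/
theorem atZero_pullback {X : FMap n ℝ} (hX : ∀ i, constantCoeff (X i) = 0)
    (f : MvPowerSeries (Fin 2 × Fin n) ℝ) :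
    atZero (pullback X f) = subst X (atZero f) := by
  have hs : IsSubstitutable X := fun i => by rw [hX i]; exact IsNilpotent.zero
  have := algHom_eq_of_X (L := atZero.comp (substAlgHom (hs.hasSubst_atPt 2)))
    (L' := (substAlgHom hs.hasSubst).comp atZero)
    (by
      simp only [AlgHom.coe_comp, coe_substAlgHom]
      exact (coeffCont_killCompl _).comp_coeffFinite (coeffCont_subst (hs.hasSubst_atPt 2)))
    (by
      simp only [AlgHom.coe_comp, coe_substAlgHom]
      exact (coeffCont_subst hs.hasSubst).comp_coeffFinite (coeffCont_killCompl _)) ?_ f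
  · simpa [pullback] using this
  · rintro ⟨p, s⟩
    simp only [AlgHom.coe_comp, Function.comp_apply, coe_substAlgHom,
      subst_X (hs.hasSubst_atPt 2)]
    fin_cases p
    · have h0 : (atZero (n := n)) (MvPowerSeries.X (0, s)) = 0 :=
        killCompl_X_eq_zero (by rintro ⟨t, ht⟩; exact absurd (show (1 : Fin 2) = 0 from congrArg Prod.fst ht) (by decide))
      simp only [Fin.zero_eta]
      rw [atZero_atPt_zero, h0, hX, map_zero, subst_zero hs.hasSubst]
    · have h1 : (atZero (n := n)) (MvPowerSeries.X (1, s)) = MvPowerSeries.X s :=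
        killCompl_X (e := secondPt n) s
      simp only [Fin.mk_one]
      rw [atZero_atPt_one, h1, subst_X hs.hasSubst]

theorem atZero_coboundary {X : FMap n ℝ} (hX : ∀ i, constantCoeff (X i) = 0) (i j : Fin n) :
    atZero (coboundary φ X i j) =
      (∑ k, ∑ l, C (constantCoeff (jac X i k)) * jac X j l * atZero (φ k l)) -
        subst X (atZero (φ i j)) := by
  simp only [coboundary_eq, map_sub, map_sum, map_mul, atZero_pullback hX, atZero_atPt_zero,
    atZero_atPt_one]

theorem coeff_coboundary_eq_zero (hφ : IsSkew φ) (h0 : VanishesAtZero φ) {X : FMap n ℝ}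
    (hX : X ∈ G0 n) (i j : Fin n) {a b : Fin n →₀ ℕ} (hab : a = 0 ∨ b = 0) :
    coeff (pairExp a b) (coboundary φ X i j) = 0 := by
  have h : ∀ i j b, coeff (pairExp 0 b) (coboundary φ X i j) = 0 := by
    intro i j b
    rw [vanishesAtZero_iff] at h0
    rw [← coeff_atZero, atZero_coboundary hX.1]
    simp [h0, subst_zero (isSubstitutable_of_mem hX).hasSubst]
  obtain rfl | rfl := hab
  · exact h i j b
  · rw [isSkew_coboundary hφ (isSubstitutable_of_mem hX) i j, map_neg, coeff_pairExp_swap, h,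
      neg_zero]

/-- Invariance of `φ(0, v)` under the linear part of `X` and `X`. -/
theorem sum_jac_atZero
    (ht : ∀ X ∈ G0 n, ∀ i j b, coeff (pairExp 0 b) (coboundary φ X i j) = 0)
    {X : FMap n ℝ} (hX : X ∈ G0 n) (i j : Fin n) :
    ∑ k, ∑ l, C (constantCoeff (jac X i k)) * jac X j l * atZero (φ k l) =
      subst X (atZero (φ i j)) := by
  rw [← sub_eq_zero, ← atZero_coboundary hX.1]
  ext b
  rw [coeff_atZero, ht X hX, coeff_zero]

theorem smul_X_mem_G0 {t : Fin n → ℝ} (ht : ∀ s, t s ≠ 0) :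
    (fun s => t s • MvPowerSeries.X s : FMap n ℝ) ∈ G0 n := by
  classical
  refine ⟨fun i => by simp, ?_⟩
  have : (Matrix.of fun i k : Fin n => coeff (Finsupp.single k 1)
      (t i • MvPowerSeries.X i : MvPowerSeries (Fin n) ℝ)) = Matrix.diagonal t := by
    ext i k
    rw [Matrix.of_apply, coeff_smul, coeff_index_single_X, Matrix.diagonal_apply]
    simp [eq_comm]
  rw [this, Matrix.det_diagonal]
  exact Finset.prod_ne_zero_iff.2 fun s _ => ht s

/-- Equivariance under diagonal matrices: `φ^{ij}(0, v)` is a multiple of `v^i v^j`. -/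
theorem atZero_eq_monomial
    (ht : ∀ X ∈ G0 n, ∀ i j b, coeff (pairExp 0 b) (coboundary φ X i j) = 0) (i j : Fin n) :
    ∃ c : ℝ, atZero (φ i j) = C c * (MvPowerSeries.X i * MvPowerSeries.X j) := by
  classical
  have hmon : ∀ b, coeff b (atZero (φ i j)) ≠ 0 →
      b = Finsupp.single i 1 + Finsupp.single j 1 := by
    intro b hb
    ext l
    -- Scaling by `2` in the direction `l` alone. Equivariance then compares `2` to the `l`-th entry
    -- of `e_i + e_j` with `2 ^ (b l)`.
    let t : Fin n → ℝ := fun s => 2 ^ (Finsupp.single s 1 l)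
    have hmem := smul_X_mem_G0 (t := t) fun s => pow_ne_zero _ two_ne_zero
    have hj : ∀ i k, jac (fun s => t s • MvPowerSeries.X s : FMap n ℝ) i k =
        if i = k then C (t i) else 0 := by
      intro i k
      rw [jac, Derivation.map_smul]
      split_ifs with h
      · rw [h, pderiv_X_self, smul_eq_C_mul, mul_one]
      · rw [pderiv_X_of_ne h, smul_zero]
    have h := congrArg (coeff b) (sum_jac_atZero ht hmem i j)
    have hr : subst (fun s => t s • MvPowerSeries.X s : FMap n ℝ) (atZero (φ i j)) =
        rescale t (atZero (φ i j)) := (rescale_eq_subst t _).symm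
    rw [hr, coeff_rescale] at h
    simp only [hj, apply_ite constantCoeff, apply_ite C, map_zero, constantCoeff_C, ite_mul,
      zero_mul, mul_ite, mul_zero, Finset.sum_ite_eq, Finset.mem_univ, if_true, ← map_mul,
      coeff_C_mul] at h
    have h2 := mul_right_cancel₀ hb h
    have h3 : (b.prod fun s m => t s ^ m) = 2 ^ (b l) := by
      rw [Finsupp.prod_fintype _ _ (by simp), Finset.prod_eq_single l]
      · simp [t]
      · intro s _ hs
        simp [t, hs]
      · simp
    rw [h3, ← pow_add] at h2
    have := pow_right_injective₀ (M₀ := ℝ) (a := 2) (by norm_num) (by norm_num) h2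
    rw [← this, Finsupp.add_apply]
  refine ⟨coeff (Finsupp.single i 1 + Finsupp.single j 1) (atZero (φ i j)), ?_⟩
  rw [X_def, X_def, monomial_mul_monomial, mul_one]
  ext b
  rw [coeff_C_mul, coeff_monomial]
  split_ifs with h
  · rw [h, mul_one]
  · rw [mul_zero]
    by_contra hb
    exact h (hmon b hb)

/-- The quadratic diffeomorphism `v^j ↦ v^j + (v^j)^2`. -/
def quadraticMap (j : Fin n) : FMap n ℝ :=
  fun s => MvPowerSeries.X s + if s = j then MvPowerSeries.X j ^ 2 else 0

theorem quadraticMap_mem_G0 (j : Fin n) : quadraticMap j ∈ G0 n := by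
  classical
  refine ⟨fun i => ?_, ?_⟩
  · rw [quadraticMap]
    split_ifs <;> simp
  · have : (Matrix.of fun i k : Fin n => coeff (Finsupp.single k 1) (quadraticMap j i)) = 1 := by
      ext i k
      have h2 : coeff (Finsupp.single k 1)
          (if i = j then MvPowerSeries.X j ^ 2 else 0 : MvPowerSeries (Fin n) ℝ) = 0 := by
        split_ifs
        · rw [coeff_X_pow, if_neg]
          intro h
          have := congrArg Finsupp.degree h
          simp at this
        · rw [coeff_zero]
      rw [Matrix.of_apply, quadraticMap, map_add, h2, add_zero, coeff_index_single_X,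
        Matrix.one_apply]
      simp [eq_comm]
    rw [this, Matrix.det_one]
    exact one_ne_zero

/-- Diagonal maps leave only a multiple `c v^i v^j`. A map with identity linear part but a quadratic
term in `v^j` does not preserve it unless `c = 0`. -/
theorem vanishesAtZero_of_tangent
    (ht : ∀ X ∈ G0 n, ∀ i j b, coeff (pairExp 0 b) (coboundary φ X i j) = 0) :
    VanishesAtZero φ := by
  classical
  rw [vanishesAtZero_iff]
  intro i j
  obtain ⟨c, hc⟩ := atZero_eq_monomial ht i j
  have hmem := quadraticMap_mem_G0 j
  have hs := (isSubstitutable_of_mem hmem).hasSubst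
  have h := sum_jac_atZero ht hmem i j
  have hj : ∀ s k, jac (quadraticMap j) s k =
      if s = k then (if s = j then 1 + 2 * MvPowerSeries.X j else 1) else 0 := by
    intro s k
    rw [jac, quadraticMap, map_add]
    by_cases hk : s = k
    · subst hk
      by_cases hsj : s = j
      · subst hsj
        simp
      · simp [hsj]
    · by_cases hsj : s = j
      · subst hsj
        simp [hk, pderiv_X_of_ne hk]
      · simp [hsj, hk, pderiv_X_of_ne hk]
  have hc0 : ∀ s k, constantCoeff (jac (quadraticMap j) s k) = if s = k then 1 else 0 := by
    intro s k
    rw [hj]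
    split_ifs <;> simp
  have hC : subst (quadraticMap j) (C c : MvPowerSeries (Fin n) ℝ) = C c := subst_C c
  rw [Finset.sum_eq_single i _ (by simp), Finset.sum_eq_single j _ (by simp), hc0, hj, if_pos rfl,
    if_pos rfl, if_pos rfl, map_one, one_mul] at h
  rotate_left
  · intro l _ hl
    rw [hj j l, if_neg hl.symm, mul_zero, zero_mul]
  · intro k _ hk
    exact Finset.sum_eq_zero fun l _ => by rw [hc0, if_neg hk.symm, map_zero, zero_mul, zero_mul]
  rw [hc, subst_mul hs, subst_mul hs, hC, subst_X hs, subst_X hs] at h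
  rw [hc]
  have hX : ∀ s : Fin n, (MvPowerSeries.X s : MvPowerSeries (Fin n) ℝ) ≠ 0 := fun s h => by
    simpa using congrArg (coeff (Finsupp.single s 1)) h
  suffices hc' : (C c : MvPowerSeries (Fin n) ℝ) = 0 by rw [hc', zero_mul]
  simp only [quadraticMap, if_true] at h
  by_cases hij : i = j
  · subst hij
    simp only [if_true] at h
    -- From `(1 + 2x) x^2 - (x + x^2)^2 = -x^4`.
    have h4 : C c * MvPowerSeries.X i ^ 4 = 0 := by linear_combination -h
    exact (mul_eq_zero.1 h4).resolve_right (pow_ne_zero _ (hX i))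
  · simp only [if_neg hij, add_zero] at h
    -- From `(1 + 2y) x y - x (y + y^2) = x y^2`.
    have h4 : C c * (MvPowerSeries.X i * MvPowerSeries.X j ^ 2) = 0 := by linear_combination h
    exact (mul_eq_zero.1 h4).resolve_right (mul_ne_zero (hX i) (pow_ne_zero _ (hX j)))

end AtZero

/-! ### The bracket on the group -/

section Bracket

variable {n : ℕ} {φ : Tensor2 n ℝ}

theorem doubleBracket_coboundary (hφ : IsSkew φ) (h0 : VanishesAtZero φ) {X : FMap n ℝ}
    (hX : X ∈ G0 n) : doubleBracket (coboundary φ) X = formalDoubleBracket φ X := by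
  classical
  funext i j k e
  rw [doubleBracket, formalDoubleBracket, bracket]
  have hinner : ∀ c : Coord n, (∑ᶠ d : Coord n,
      partialX c (fun X' => coeff (pairExp (e.curry 0) (e.curry 1)) (coboundary φ X' i j)) X *
        partialX d (fun X' => coeff (e.curry 2) (X' k)) X *
        coeff (pairExp c.2.1 d.2.1) (coboundary φ X c.1 d.1)) =
      TrivSqZeroExt.snd (coeff (pairExp (e.curry 0) (e.curry 1))
          (coboundary φ (perturb X c.1 c.2.1) i j)) *
        coeff (pairExp c.2.1 (e.curry 2)) (coboundary φ X c.1 k) := by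
    intro c
    simp only [partialX_coboundary φ hX, partialX_coeff]
    -- The constant term of `X^k` is not a coordinate: every term on the left vanishes, while the
    -- right side vanishes by `coeff_coboundary_eq_zero`.
    by_cases ha : e.curry 2 = 0
    · rw [ha, coeff_coboundary_eq_zero hφ h0 hX c.1 k (Or.inr rfl), mul_zero]
      refine finsum_eq_zero_of_forall_eq_zero fun d => ?_
      rw [if_neg fun h => d.2.2 h.2.symm, mul_zero, zero_mul]
    · rw [finsum_eq_single _ (k, ⟨e.curry 2, ha⟩)]
      · simp
      · rintro ⟨s, d, hd⟩ hne
        rw [if_neg, mul_zero, zero_mul]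
        rintro ⟨rfl, rfl⟩
        exact hne rfl
  rw [finsum_congr hinner]
  let g : Coord n → Fin n × (Fin n →₀ ℕ) := fun c => (c.1, c.2.1)
  have hg : Function.Injective g := by
    rintro ⟨s, c⟩ ⟨s', c'⟩ h
    obtain ⟨h1, h2⟩ := Prod.mk.inj h
    exact Prod.ext h1 (Subtype.ext h2)
  symm
  -- Labels with zero multi-index drop out of the formal sum, because the corresponding components
  -- of `Ω` are zero.
  rw [← finsum_mem_univ, finsum_mem_inter_support_eq' _ _ (Set.range g), finsum_mem_range hg]
  rintro ⟨s, a⟩ hx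
  refine ⟨fun _ => ⟨(s, ⟨a, ?_⟩), rfl⟩, fun _ => Set.mem_univ _⟩
  rintro rfl
  refine hx ?_
  dsimp only
  rw [coeff_coboundary_eq_zero hφ h0 hX s k (Or.inl rfl), mul_zero]

theorem isJacobi_iff (hφ : IsSkew φ) (h0 : VanishesAtZero φ) :
    IsJacobi (coboundary (R := ℝ) φ) ↔ IsInvariant (Phi φ) := by
  rw [← isFormalJacobi_iff hφ]
  refine forall₂_congr fun X hX => ?_
  rw [doubleBracket_coboundary hφ h0 hX]

theorem isPoissonLie_iff (hφ : IsSkew φ) :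
    IsPoissonLie (coboundary (R := ℝ) φ) ↔ VanishesAtZero φ ∧ IsInvariant (Phi φ) := by
  refine ⟨fun h => ?_, fun ⟨h0, h⟩ => ?_⟩
  · have h0 : VanishesAtZero φ :=
      vanishesAtZero_of_tangent fun X hX i j b => h.tangent X hX i j 0 b (Or.inl rfl)
    exact ⟨h0, (isJacobi_iff hφ h0).1 h.jacobi⟩
  · exact
      { smooth := isSmooth_coboundary φ
        tangent := fun X hX i j a b => coeff_coboundary_eq_zero hφ h0 hX i j
        skew := fun X hX => isSkew_coboundary hφ (isSubstitutable_of_mem hX)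
        multiplicative := isMultiplicative_coboundary φ
        jacobi := (isJacobi_iff hφ h0).2 h }

theorem isInvariant_zero : IsInvariant (0 : Tensor3 n ℝ) := by
  intro X hX i j k
  simp [pullback, subst_zero ((isSubstitutable_of_mem hX).hasSubst_atPt 3)]

end Bracket

end

end FormalDiff

theorem proposition3p3 (n : ℕ) (φ : FormalDiff.Tensor2 n ℝ) (hφ : FormalDiff.IsSkew φ) :
    -- the coboundary tensor of an arbitrary skew `φ`
    (((∀ X ∈ FormalDiff.G0 n, FormalDiff.IsSkew (FormalDiff.coboundary φ X)) ∧
        FormalDiff.IsMultiplicative (FormalDiff.coboundary (R := ℝ) φ) ∧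
        FormalDiff.IsFormalJacobi φ) ↔ FormalDiff.IsInvariant (FormalDiff.Phi φ)) ∧
    (FormalDiff.IsFormalJacobi φ ↔ FormalDiff.IsInvariant (FormalDiff.Phi φ)) ∧
    -- structures on the group fixing the origin
    (FormalDiff.IsPoissonLie (FormalDiff.coboundary (R := ℝ) φ) ↔
      FormalDiff.VanishesAtZero φ ∧ FormalDiff.IsInvariant (FormalDiff.Phi φ)) ∧
    (FormalDiff.VanishesAtZero φ →
      (FormalDiff.IsJacobi (FormalDiff.coboundary (R := ℝ) φ) ↔
        FormalDiff.IsInvariant (FormalDiff.Phi φ))) ∧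
    -- the classical Yang-Baxter equation suffices
    (FormalDiff.Phi φ = 0 →
      FormalDiff.IsFormalJacobi φ ∧
      (FormalDiff.VanishesAtZero φ →
        FormalDiff.IsPoissonLie (FormalDiff.coboundary (R := ℝ) φ))) := by
  have hJ := FormalDiff.isFormalJacobi_iff hφ
  refine ⟨⟨fun h => hJ.1 h.2.2, fun h => ⟨fun X hX => FormalDiff.isSkew_coboundary hφ
      (FormalDiff.isSubstitutable_of_mem hX), FormalDiff.isMultiplicative_coboundary φ, hJ.2 h⟩⟩,
    hJ, FormalDiff.isPoissonLie_iff hφ, FormalDiff.isJacobi_iff hφ, fun h => ?_⟩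
  have hI : FormalDiff.IsInvariant (FormalDiff.Phi φ) := h ▸ FormalDiff.isInvariant_zero
  exact ⟨hJ.2 hI, fun h0 => (FormalDiff.isPoissonLie_iff hφ).2 ⟨h0, hI⟩⟩
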